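/- Let $m\ge 1$ be an integer and $\Omega_m=\{0,1,\dots,m\}$. For $q\in(1,m+1]$ a $q$-expansion of $x$ is a sequence $(c_i)_{i\ge1}\in\Omega_m^{\mathbb N}$ with $x=\sum_{i\ge1}c_iq^{-i}$. Let $\mathcal U_q$ be the set of $x\in[0,\frac m{q-1}]$ that have a unique $q$-expansion, $\mathcal U_q'\subseteq\Omega_m^{\mathbb N}$ the set of these unique expansions, $\mathcal U=\{q\in(1,m+1]:1\in\mathcal U_q\}$ and $\overline{\mathcal U}$ its closure in $\mathbb R$. Put $M=\lfloor m/2\rfloor+1$. The reflection of a word or sequence is obtained by replacing every digit $c$ by $m-c$; it is written $\overline{\,\cdot\,}$. Write $w^+$ (resp. $w^-$) for the word $w$ with its last digit increased (resp. decreased) by $1$. Words of equal length and sequences are compared lexicographically. A sequence is infinite if it has no last nonzero digit, and $\alpha(q)$ denotes the quasi-greedy expansion of $1$, i.e. the largest infinite $q$-expansion of $1$. Let $(q_0,q_0^*)$ be a connected component of $(M,m+1]\setminus\overline{\mathcal U}$ with $q_0>M$, and let $\alpha(q_0)=(a_1\cdots a_n)^\infty$, where $a_1\cdots a_n$ is the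 smallest periodic block. Define the words $c_\ell$ by $$c_0^-=a_1\cdots a_n,\quad\text{i.e. } c_0=a_1\cdots a_n^+,\qquad c_{\ell+1}=c_\ell\,\overline{c_\ell}^{\,+}\quad(\ell\ge0).$$ A word $u_1\cdots u_p\in\Omega_m^p$ ($p\ge1$) is called matched to $a_1\cdots a_n$ if $u_p<m$ and for every $1\le\ell\le p$ the word $v^{(\ell)}$ consisting of the digits number $\ell+1,\dots,\ell+n$ of $u_1\cdots u_pa_1\cdots a_n$ satisfies $$v^{(\ell)}\le a_1\cdots a_n\ \text{ whenever } u_1\cdots u_\ell\ne m^\ell,\qquad v^{(\ell)}\ge\overline{a_1\cdots a_n}\ \text{ whenever } u_1\cdots u_\ell\ne0^\ell .$$ **Theorem.** Let $(b_i)\in\Omega_m^{\mathbb N}$. Then $(b_i)\in\mathcal U_{q_0^*}'\setminus\mathcal U_{q_0}'$ if and only if $(b_i)$ or its reflection $\overline{(b_i)}$ is an infinite sequence of the form $$\omega\,(c_0^-)^j\,(c_{i_1}\overline{c_{i_1}})^{j_1}(c_{i_1}\overline{c_{i_2}})^{l_1}(c_{i_2}\overline{c_{i_2}})^{j_2}(c_{i_2}\overline{c_{i_3}})^{l_2}\cdots,$$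 where $\omega$ is a word matched to $a_1\cdots a_n$, $j\in\{0,\infty\}$, $0\le i_1<i_2<\cdots$ are integers, and $0\le j_r\le\infty$ and $l_r\in\{0,1\}$ for all $r\ge1$. (If an exponent is $\infty$, whatever follows that power is disregarded; if all exponents are finite, the product must contain infinitely many nonempty factors, so that it is an infinite sequence.) -/

import Mathlib

/-!
Expansions in non-integer bases over the alphabet `{0, 1, …, m}`, modelled by `Fin (m + 1)`.
Infinite sequences are functions `ℕ → Fin (m + 1)` (the digit with index `i` is the coefficient of
`q ^ (-(i + 1))`), finite words are lists.
-/

namespace QExpansion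

variable {m : ℕ}

/-- The sequence `c` is a `q`-expansion of `x`, i.e. `x = ∑_{i ≥ 1} c_i / q ^ i`. -/
def IsExpansion (q x : ℝ) (c : ℕ → Fin (m + 1)) : Prop :=
  HasSum (fun i : ℕ => ((c i : ℕ) : ℝ) / q ^ (i + 1)) x

/-- `U_q`: the points of `[0, m / (q - 1)]` which have a unique `q`-expansion. -/
def univoqueSet (m : ℕ) (q : ℝ) : Set ℝ :=
  {x | x ∈ Set.Icc (0 : ℝ) ((m : ℝ) / (q - 1)) ∧ ∃! c : ℕ → Fin (m + 1), IsExpansion q x c}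

/-- `U'_q`: the set of the `q`-expansions of the elements of `U_q`. -/
def univoqueSeqs (m : ℕ) (q : ℝ) : Set (ℕ → Fin (m + 1)) :=
  {c | ∃ x ∈ univoqueSet m q, IsExpansion q x c}

/-- `U`: the set of univoque bases. -/
def univoqueBases (m : ℕ) : Set ℝ :=
  {q | q ∈ Set.Ioc (1 : ℝ) ((m : ℝ) + 1) ∧ (1 : ℝ) ∈ univoqueSet m q}

/-- `(M, m + 1] ∖ closure U`, where `M = ⌊m / 2⌋ + 1`. -/
def complementSet (m : ℕ) : Set ℝ :=
  Set.Ioc (((m / 2 + 1 : ℕ)) : ℝ) ((m : ℝ) + 1) \ closure (univoqueBases m)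

/-- The open interval `(p, r)` is a connected component of the subset `S` of the real line. -/
def IsComponentInterval (S : Set ℝ) (p r : ℝ) : Prop :=
  ∃ x ∈ S, connectedComponentIn S x = Set.Ioo p r

/-- A sequence is infinite if it does not have a last nonzero digit. -/
def IsInfinite (c : ℕ → Fin (m + 1)) : Prop :=
  ¬ ∃ i, c i ≠ 0 ∧ ∀ k, i < k → c k = 0

/-- `c` is the quasi-greedy expansion of `x`: the lexicographically largest infinite
`q`-expansion of `x`. -/
def IsQuasiGreedy (q x : ℝ) (c : ℕ → Fin (m + 1)) : Prop :=
  IsExpansion q x c ∧ IsInfinite c ∧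
    ∀ d : ℕ → Fin (m + 1), IsExpansion q x d → IsInfinite d → toLex d ≤ toLex c

/-- The reflection `(m - b_i)` of a sequence. -/
def reflectSeq (b : ℕ → Fin (m + 1)) : ℕ → Fin (m + 1) := fun i => (b i).rev

/-- The reflection of a word. -/
def reflect (w : List (Fin (m + 1))) : List (Fin (m + 1)) := w.map Fin.rev

/-- The word `w⁺`: the last digit is increased by one (meaningful if that digit is less than `m`).
-/
def incrLast : List (Fin (m + 1)) → List (Fin (m + 1))
  | [] => []
  | [x] => [x + 1]
  | x :: y :: t => x :: incrLast (y :: t)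

/-- The words `c_ℓ` generated by `c₀⁻ = a`: `c₀ = a⁺` and `c_{ℓ+1} = c_ℓ (reflection of c_ℓ)⁺`. -/
def blockWord (a : List (Fin (m + 1))) : ℕ → List (Fin (m + 1))
  | 0 => incrLast a
  | l + 1 => blockWord a l ++ incrLast (reflect (blockWord a l))

/-- The infinite sequence `w^∞` (for a nonempty word `w`). -/
def periodicSeq (w : List (Fin (m + 1))) : ℕ → Fin (m + 1) :=
  fun i => w.getD (i % w.length) 0

/-- The sequence `w s`: the word `w` followed by the sequence `s`. -/
def appendSeq (w : List (Fin (m + 1))) (s : ℕ → Fin (m + 1)) : ℕ → Fin (m + 1) :=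
  fun i => if i < w.length then w.getD i 0 else s (i - w.length)

/-- `a` is the smallest periodic block of the sequence `s`: `s = a^∞`, and no positive number
smaller than the length of `a` is a period of `s`. -/
def IsSmallestBlock (a : List (Fin (m + 1))) (s : ℕ → Fin (m + 1)) : Prop :=
  a ≠ [] ∧ s = periodicSeq a ∧ ∀ p : ℕ, 0 < p → (∀ i, s (i + p) = s i) → a.length ≤ p

/-- The word `u` is matched to the word `a` of length `n`: it is nonempty, its last digit is less
than `m`, and for `1 ≤ l ≤ |u|` the block of length `n` which starts after the first `l` digits of
`u a` satisfies the two stated lexicographic inequalities (between words of equal length). -/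
def Matched (a u : List (Fin (m + 1))) : Prop :=
  (∃ h : u ≠ [], u.getLast h < Fin.last m) ∧
  ∀ l : ℕ, 1 ≤ l → l ≤ u.length →
    (u.take l ≠ List.replicate l (Fin.last m) → ((u ++ a).drop l).take a.length ≤ a) ∧
    (u.take l ≠ List.replicate l 0 → reflect a ≤ ((u ++ a).drop l).take a.length)

/-- The finite word `w_0^{e_0} w_1^{e_1} … w_{N-1}^{e_{N-1}}` (for finite exponents). -/
def finProd (F : ℕ → List (Fin (m + 1)) × ℕ∞) (N : ℕ) : List (Fin (m + 1)) :=
  ((List.range N).map fun s => (List.replicate (F s).2.toNat (F s).1).flatten).flatten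

/-- The infinite sequence `b` equals `w_0^{e_0} w_1^{e_1} w_2^{e_2} …`, where `F s = (w_s, e_s)` and
`e_s ∈ {0, 1, …, ∞}`. If some exponent is `∞`, the sequence ends with the first such power, and
what follows it is disregarded. If all exponents are finite, the lengths of the finite partial
products have to be unbounded, so that they determine an infinite sequence. -/
def IsInfProd (F : ℕ → List (Fin (m + 1)) × ℕ∞) (b : ℕ → Fin (m + 1)) : Prop :=
  (∃ r, (∀ s, s < r → (F s).2 ≠ ⊤) ∧ (F r).2 = ⊤ ∧
      b = appendSeq (finProd F r) (periodicSeq (F r).1)) ∨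
  ((∀ s, (F s).2 ≠ ⊤) ∧
    (∀ N, ∃ t : ℕ → Fin (m + 1), b = appendSeq (finProd F N) t) ∧
    ∀ L : ℕ, ∃ N, L ≤ (finProd F N).length)

/-- The successive factors of
`(c₀⁻)^j (c_{i_1} c̄_{i_1})^{j_1} (c_{i_1} c̄_{i_2})^{l_1} (c_{i_2} c̄_{i_2})^{j_2} ⋯`
(with `i_1, i_2, …` written `i 0, i 1, …`, and likewise for `j_r` and `l_r`). -/
def factors (a : List (Fin (m + 1))) (j : ℕ∞) (i : ℕ → ℕ) (js : ℕ → ℕ∞) (l : ℕ → ℕ) :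
    ℕ → List (Fin (m + 1)) × ℕ∞
  | 0 => (a, j)
  | s + 1 =>
    if s % 2 = 0 then
      (blockWord a (i (s / 2)) ++ reflect (blockWord a (i (s / 2))), js (s / 2))
    else
      (blockWord a (i (s / 2)) ++ reflect (blockWord a (i (s / 2 + 1))), (l (s / 2) : ℕ∞))

/-- The sequence `b` is of the form
`ω (c₀⁻)^j (c_{i_1} c̄_{i_1})^{j_1} (c_{i_1} c̄_{i_2})^{l_1} (c_{i_2} c̄_{i_2})^{j_2} ⋯`
with `ω` matched to `a`, `j ∈ {0, ∞}`, `0 ≤ i_1 < i_2 < ⋯`, `0 ≤ j_r ≤ ∞` and `0 ≤ l_r ≤ 1`. -/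
def HasForm (a : List (Fin (m + 1))) (b : ℕ → Fin (m + 1)) : Prop :=
  ∃ (w : List (Fin (m + 1))) (j : ℕ∞) (i : ℕ → ℕ) (js : ℕ → ℕ∞) (l : ℕ → ℕ)
    (s : ℕ → Fin (m + 1)),
    Matched a w ∧ (j = 0 ∨ j = ⊤) ∧ StrictMono i ∧ (∀ r, l r ≤ 1) ∧
    IsInfProd (factors a j i js l) s ∧ b = appendSeq w s

end QExpansion

namespace QExpansion

variable {m : ℕ}

/-! ### Lexicographic order and shifts -/

/-! The problem is reduced to lexicographic order. A sequence is a unique `q`-expansion exactly when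
each of its tails that follows a digit below `m` is strictly smaller than `α(q)`, and the same holds
for its reflection (`mem_univoqueSeqs_iff`). Hence only the two sequences `α(q₀)` and `α(q₀*)`
matter.

The first one is `x = a^∞`. The second one is the limit `c` of the words `c_ℓ` (`Tower.good_right`).
Indeed, doubling `w ↦ w w̄⁺` preserves admissibility (`Adm.doubles`), so all proper tails of `c` lie
strictly between `c̄` and `c`. Therefore `c = α(p)` for some univoque base `p > q₀`. A univoque base
between `q₀` and `p` would have its expansion of `1` strictly between `x` and `c`, which is
impossible (`Tower.gap`).

Let now `b` satisfy the conditions for `c` but not those for `x`. Up to reflection, the earliest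
violation is a digit below `m` followed by a tail `y` with `x ≤ y < c`, and all tails of `y` lie
strictly between `c̄` and `c`. Either `y = a^∞`, or `y` consists of finitely many copies of `a`
followed by a sequence that starts with `c_0`. From there on the two bounds leave little freedom
(`Doubles.next_block`): a block `c_i` is followed by `c̄_i`, or it is the first half of `c_{i+1}`;
the mirrored statement holds for `c̄_i`. A block cannot be enlarged forever, since the tail would
then be `c` or `c̄`. So `y` is a chain of alternately plain and reflected blocks with nondecreasing
indices, and grouping it in pairs gives the stated product (`exists_isInfProd`). The leading copies
of `a` are absorbed into `ω`, which is why `j` is `0` or `∞`.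

Conversely, all tails of such a chain lie between `c̄` and `c` (`tailsBetween_of_pairs`). A tail
that starts inside `ω` is controlled by its first `n` digits only: if they form a word at most `a`,
the tail is below `c`, because `c` starts with `a⁺`. The last digit of `ω`, being below `m` and
followed by a sequence not smaller than `x`, violates the condition for `q₀`. -/

/-- Strict lexicographic order on sequences. -/
def SeqLT (x y : ℕ → Fin (m + 1)) : Prop := ∃ k, (∀ j < k, x j = y j) ∧ x k < y k

/-- The sequence without its first `k` digits. -/
def shift (k : ℕ) (x : ℕ → Fin (m + 1)) : ℕ → Fin (m + 1) := fun i => x (k + i)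

@[simp] theorem shift_apply (k i : ℕ) (x : ℕ → Fin (m + 1)) : shift k x i = x (k + i) := rfl

@[simp] theorem reflectSeq_apply (x : ℕ → Fin (m + 1)) (i : ℕ) :
    reflectSeq x i = (x i).rev := rfl

@[simp] theorem shift_zero (x : ℕ → Fin (m + 1)) : shift 0 x = x := by
  funext i; simp

theorem shift_shift (k l : ℕ) (x : ℕ → Fin (m + 1)) : shift k (shift l x) = shift (l + k) x := by
  funext i; simp [Nat.add_assoc]

theorem reflectSeq_reflectSeq (x : ℕ → Fin (m + 1)) : reflectSeq (reflectSeq x) = x := by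
  funext i; simp

theorem shift_reflectSeq (k : ℕ) (x : ℕ → Fin (m + 1)) :
    shift k (reflectSeq x) = reflectSeq (shift k x) := rfl

theorem SeqLT.reflect {x y : ℕ → Fin (m + 1)} (h : SeqLT x y) :
    SeqLT (reflectSeq y) (reflectSeq x) := by
  obtain ⟨k, h1, h2⟩ := h
  exact ⟨k, fun j hj => by simp [h1 j hj], by simpa using h2⟩

theorem seqLT_reflect_iff {x y : ℕ → Fin (m + 1)} :
    SeqLT (reflectSeq y) (reflectSeq x) ↔ SeqLT x y :=
  ⟨fun h => by simpa [reflectSeq_reflectSeq] using h.reflect, SeqLT.reflect⟩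

theorem SeqLT.trans {x y z : ℕ → Fin (m + 1)} (h : SeqLT x y) (h' : SeqLT y z) : SeqLT x z := by
  obtain ⟨k, h1, h2⟩ := h
  obtain ⟨l, h3, h4⟩ := h'
  rcases lt_trichotomy k l with hkl | rfl | hkl
  · exact ⟨k, fun j hj => (h1 j hj).trans (h3 j (hj.trans hkl)), (h3 k hkl) ▸ h2⟩
  · exact ⟨k, fun j hj => (h1 j hj).trans (h3 j hj), h2.trans h4⟩
  · exact ⟨l, fun j hj => (h1 j (hj.trans hkl)).trans (h3 j hj), (h1 l hkl) ▸ h4⟩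

theorem SeqLT.irrefl (x : ℕ → Fin (m + 1)) : ¬ SeqLT x x := fun ⟨_, _, h⟩ => lt_irrefl _ h

theorem SeqLT.asymm {x y : ℕ → Fin (m + 1)} (h : SeqLT x y) : ¬ SeqLT y x :=
  fun h' => SeqLT.irrefl _ (h.trans h')

theorem seqLT_trichotomy (x y : ℕ → Fin (m + 1)) : SeqLT x y ∨ x = y ∨ SeqLT y x := by
  by_cases h : ∃ k, x k ≠ y k
  · classical
    have h1 : ∀ j < Nat.find h, x j = y j := fun j hj => not_not.1 (Nat.find_min h hj)
    rcases lt_or_gt_of_ne (Nat.find_spec h) with h2 | h2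
    · exact Or.inl ⟨_, h1, h2⟩
    · exact Or.inr (Or.inr ⟨_, fun j hj => (h1 j hj).symm, h2⟩)
  · push Not at h
    exact Or.inr (Or.inl (funext h))

theorem SeqLT.trans_not {x y z : ℕ → Fin (m + 1)} (h : SeqLT x y) (h' : ¬ SeqLT z y) :
    SeqLT x z := by
  rcases seqLT_trichotomy y z with h1 | h1 | h1
  · exact h.trans h1
  · exact h1 ▸ h
  · exact absurd h1 h'

/-- Two sequences have the same first `L` digits. -/
def AgreeOn (L : ℕ) (x y : ℕ → Fin (m + 1)) : Prop := ∀ j < L, x j = y j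

theorem AgreeOn.symm {L : ℕ} {x y : ℕ → Fin (m + 1)} (h : AgreeOn L x y) : AgreeOn L y x :=
  fun j hj => (h j hj).symm

theorem AgreeOn.trans {L : ℕ} {x y z : ℕ → Fin (m + 1)} (h : AgreeOn L x y)
    (h' : AgreeOn L y z) : AgreeOn L x z :=
  fun j hj => (h j hj).trans (h' j hj)

theorem AgreeOn.mono {L K : ℕ} {x y : ℕ → Fin (m + 1)} (h : AgreeOn L x y) (hK : K ≤ L) :
    AgreeOn K x y := fun j hj => h j (hj.trans_le hK)

theorem AgreeOn.reflect {L : ℕ} {x y : ℕ → Fin (m + 1)} (h : AgreeOn L x y) :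
    AgreeOn L (reflectSeq x) (reflectSeq y) := fun j hj => by simp [h j hj]

theorem AgreeOn.le_of_lt {k : ℕ} {x y : ℕ → Fin (m + 1)} (h : AgreeOn k x y)
    (hxy : ¬ SeqLT y x) : x k ≤ y k := by
  by_contra hk
  exact hxy ⟨k, h.symm, not_le.1 hk⟩

/-! ### Admissible prefixes -/

/-- The prefix of length `L` of `c` is an admissible word. -/
structure Adm (L : ℕ) (c : ℕ → Fin (m + 1)) : Prop where
  pos : 0 < L
  head : (c 0).rev < c 0
  upper : ∀ i, 0 < i → i < L → (∀ j, i + j < L → c (i + j) = c j) ∨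
    ∃ k, i + k < L ∧ (∀ j < k, c (i + j) = c j) ∧ c (i + k) < c k
  lower : ∀ i, 0 < i → i < L →
    ∃ k, i + k < L ∧ (∀ j < k, c (i + j) = (c j).rev) ∧ (c k).rev < c (i + k)

/-- The prefix of length `2 L` of `c` is `w w̄⁺`, where `w` is its prefix of length `L`. -/
def Doubles (L : ℕ) (c : ℕ → Fin (m + 1)) : Prop :=
  (∀ j, j + 1 < L → c (L + j) = (c j).rev) ∧
    (c (L + (L - 1)) : ℕ) = ((c (L - 1)).rev : ℕ) + 1

theorem Doubles.rev_le {L : ℕ} {c : ℕ → Fin (m + 1)} (hd : Doubles L c) {j : ℕ} (hj : j < L) :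
    (c j).rev ≤ c (L + j) := by
  by_cases h : j + 1 < L
  · exact (hd.1 j h).ge
  · obtain rfl : j = L - 1 := by omega
    have := hd.2
    rw [Fin.le_def]; omega

/-- Reflection exchanges the two bounds, so tails in the second half inherit each bound from the
other one for the first half. The raised last digit can at worst turn a strict upper inequality into
equality up to the end, and it makes the lower inequality strict where the word has a border. For a
border in the first half, the strict lower bound at the complementary position decides the upper
inequality. -/
theorem Adm.doubles {L : ℕ} {c : ℕ → Fin (m + 1)} (h : Adm L c) (hd : Doubles L c) :
    Adm (2 * L) c := by
  have hL := h.pos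
  have hd1 := hd.1
  have hd2 := hd.2
  have hlast : (c (L - 1)).rev < c (L + (L - 1)) := by
    rw [Fin.lt_def]; omega
  refine ⟨by omega, h.head, ?_, ?_⟩
  · intro i hi hi2
    rcases lt_trichotomy i L with hiL | rfl | hiL
    · rcases h.upper i hi hiL with hu | ⟨k, hk, hk1, hk2⟩
      · right
        obtain ⟨k, hk, hk1, hk2⟩ := h.lower (L - i) (by omega) (by omega)
        refine ⟨L - i + k, by omega, ?_, ?_⟩
        · intro j hj
          by_cases hjL : i + j < L
          · exact hu j hjL
          · have e1 : i + j = L + (j - (L - i)) := by omega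
            have e2 : j = L - i + (j - (L - i)) := by omega
            rw [e1, hd1 _ (by omega)]
            conv_rhs => rw [e2]
            rw [hk1 _ (by omega)]
        · rw [show i + (L - i + k) = L + k by omega, hd1 _ (by omega)]
          exact hk2
      · exact Or.inr ⟨k, by omega, hk1, hk2⟩
    · by_cases h1 : i = 1
      · subst h1
        have h2 : c (1 + 0) ≤ c 0 := by
          have := h.head
          rw [Fin.lt_def] at this
          simp only [Nat.sub_self] at hd2
          rw [Fin.le_def]; omega
        rcases h2.lt_or_eq with h2 | h2
        · exact Or.inr ⟨0, by omega, by simp, h2⟩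
        · left
          intro j hj
          obtain rfl : j = 0 := by omega
          exact h2
      · refine Or.inr ⟨0, by omega, by simp, ?_⟩
        rw [hd1 0 (by omega)]; exact h.head
    · obtain ⟨i', rfl⟩ : ∃ i', i = L + i' := ⟨i - L, by omega⟩
      obtain ⟨k, hk, hk1, hk2⟩ := h.lower i' (by omega) (by omega)
      have hag : ∀ j < k, c (L + i' + j) = c j := by
        intro j hj
        rw [Nat.add_assoc, hd1 _ (by omega), hk1 j hj, Fin.rev_rev]
      by_cases hkL : i' + k + 1 < L
      · refine Or.inr ⟨k, by omega, hag, ?_⟩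
        rw [Nat.add_assoc, hd1 _ hkL]
        exact Fin.rev_lt_iff.1 hk2
      · have hle : c (L + i' + k) ≤ c k := by
          have e : i' + k = L - 1 := by omega
          rw [Nat.add_assoc, e, Fin.le_def, hd2]
          rw [e] at hk2
          have := Fin.rev_lt_iff.1 hk2
          rw [Fin.lt_def] at this
          omega
        rcases hle.lt_or_eq with hlt | heq
        · exact Or.inr ⟨k, by omega, hag, hlt⟩
        · left
          intro j hj
          rcases (show j ≤ k by omega).lt_or_eq with hj' | rfl
          · exact hag j hj'
          · exact heq
  · intro i hi hi2
    rcases lt_trichotomy i L with hiL | rfl | hiL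
    · obtain ⟨k, hk, hk1, hk2⟩ := h.lower i hi hiL
      exact ⟨k, by omega, hk1, hk2⟩
    · exact ⟨i - 1, by omega, fun j hj => hd1 j (by omega), hlast⟩
    · obtain ⟨i', rfl⟩ : ∃ i', i = L + i' := ⟨i - L, by omega⟩
      rcases h.upper i' (by omega) (by omega) with hu | ⟨k, hk, hk1, hk2⟩
      · refine ⟨L - 1 - i', by omega, ?_, ?_⟩
        · intro j hj
          rw [Nat.add_assoc, hd1 _ (by omega), hu j (by omega)]
        · rw [← hu _ (by omega), show i' + (L - 1 - i') = L - 1 by omega,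
            show L + i' + (L - 1 - i') = L + (L - 1) by omega]
          exact hlast
      · refine ⟨k, by omega, ?_, ?_⟩
        · intro j hj
          rw [Nat.add_assoc, hd1 _ (by omega), hk1 j hj]
        · rw [Nat.add_assoc]
          exact (Fin.rev_lt_rev.2 hk2).trans_le (hd.rev_le (by omega))

/-- Tails which start inside an admissible block that is followed by its reflection, up to the
last digit of the latter. -/
theorem Adm.shift_lt {L : ℕ} {c y : ℕ → Fin (m + 1)} (h : Adm L c) (hy : AgreeOn L y c)
    (hy' : AgreeOn (L - 1) (shift L y) (reflectSeq c)) {i : ℕ} (hi : 0 < i) (hiL : i < L) :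
    SeqLT (shift i y) c := by
  rcases h.upper i hi hiL with hu | ⟨k, hk, hk1, hk2⟩
  · obtain ⟨k, hk, hk1, hk2⟩ := h.lower (L - i) (by omega) (by omega)
    refine ⟨L - i + k, ?_, ?_⟩
    · intro j hj
      by_cases hjL : i + j < L
      · rw [shift_apply, hy _ hjL, hu j hjL]
      · have e1 : i + j = L + (j - (L - i)) := by omega
        have e2 : j = L - i + (j - (L - i)) := by omega
        rw [shift_apply, e1, ← shift_apply L _ y, hy' _ (by omega)]
        conv_rhs => rw [e2]
        rw [hk1 _ (by omega), reflectSeq_apply]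
    · rw [shift_apply, show i + (L - i + k) = L + k by omega, ← shift_apply L _ y, hy' _ (by omega)]
      exact hk2
  · refine ⟨k, fun j hj => ?_, ?_⟩
    · rw [shift_apply, hy _ (by omega), hk1 j hj]
    · rw [shift_apply, hy _ hk]; exact hk2

/-- The lower inequality of an admissible word is decided inside the word, so the digits of `y`
after the first `L` play no role. -/
theorem Adm.reflect_lt_shift {L : ℕ} {c y : ℕ → Fin (m + 1)} (h : Adm L c) (hy : AgreeOn L y c)
    {i : ℕ} (hiL : i < L) : SeqLT (reflectSeq c) (shift i y) := by
  rcases Nat.eq_zero_or_pos i with rfl | hi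
  · refine ⟨0, by simp, ?_⟩
    simpa [hy 0 h.pos] using h.head
  · obtain ⟨k, hk, hk1, hk2⟩ := h.lower i hi hiL
    refine ⟨k, fun j hj => ?_, ?_⟩
    · rw [shift_apply, hy _ (by omega), hk1 j hj, reflectSeq_apply]
    · rw [shift_apply, hy _ hk]; exact hk2

/-- The block which follows a maximal prefix shared with `c`. -/
theorem Doubles.next_block {L : ℕ} {c y : ℕ → Fin (m + 1)} (hL : 0 < L) (hd : Doubles L c)
    (hy : AgreeOn L y c) (hyc : SeqLT y c) (hc : SeqLT (reflectSeq c) (shift L y)) :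
    AgreeOn L (shift L y) (reflectSeq c) ∨ AgreeOn (2 * L) y c := by
  obtain ⟨k, hk1, hk2⟩ := hyc
  have hkL : L ≤ k := by
    by_contra hkL
    exact hk2.ne (hy k (by omega))
  obtain ⟨j, rfl⟩ : ∃ j, k = L + j := ⟨k - L, by omega⟩
  by_cases hjL : L ≤ j
  · exact Or.inr fun i hi => hk1 i (by omega)
  · left
    -- Before its last digit, the second half of the doubled word equals the reflection of the first
    -- half, so upper and lower bound coincide there. At the last digit the upper bound is larger by
    -- one and is not attained, which again leaves only the reflected digit.
    have hag : AgreeOn j (shift L y) (reflectSeq c) := by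
      intro i hi
      rw [shift_apply, hk1 _ (by omega), hd.1 _ (by omega), reflectSeq_apply]
    have hle := hag.symm.le_of_lt hc.asymm
    simp only [reflectSeq_apply, shift_apply] at hle
    have hlast : j = L - 1 := by
      by_contra hne
      rw [hd.1 j (by omega)] at hk2
      exact absurd hle (not_le.2 hk2)
    intro i hi
    rcases (show i ≤ j by omega).lt_or_eq with hij | rfl
    · exact hag i hij
    · have := hd.2
      rw [← hlast] at this
      rw [Fin.le_def] at hle
      rw [Fin.lt_def] at hk2
      rw [shift_apply, reflectSeq_apply, Fin.ext_iff]
      omega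

theorem Doubles.next_block_reflect {L : ℕ} {c y : ℕ → Fin (m + 1)} (hL : 0 < L)
    (hd : Doubles L c) (hy : AgreeOn L y (reflectSeq c)) (hyc : SeqLT (reflectSeq c) y)
    (hc : SeqLT (shift L y) c) :
    AgreeOn L (shift L y) c ∨ AgreeOn (2 * L) y (reflectSeq c) := by
  have h := hd.next_block hL (y := reflectSeq y)
    (by simpa [reflectSeq_reflectSeq] using hy.reflect)
    (by simpa [reflectSeq_reflectSeq] using hyc.reflect) hc.reflect
  refine h.imp (fun h => ?_) fun h => ?_
  · simpa [shift_reflectSeq, reflectSeq_reflectSeq] using h.reflect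
  · simpa [reflectSeq_reflectSeq] using h.reflect

/-! ### The limit sequence -/

theorem len_mono {k l : ℕ} (n : ℕ) (h : k ≤ l) : n * 2 ^ k ≤ n * 2 ^ l :=
  Nat.mul_le_mul_left _ (Nat.pow_le_pow_right (by norm_num) h)

/-- `x` is periodic with block `c₀⁻`, and `c` is the limit of the words `c_ℓ`; `n` is the length
of the block. -/
structure Tower (n : ℕ) (x c : ℕ → Fin (m + 1)) : Prop where
  periodic : ∀ i, x (n + i) = x i
  agree : AgreeOn (n - 1) x c
  incr : (c (n - 1) : ℕ) = (x (n - 1) : ℕ) + 1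
  adm : Adm n c
  doubles : ∀ l, Doubles (n * 2 ^ l) c

namespace Tower

variable {n : ℕ} {x c : ℕ → Fin (m + 1)} (T : Tower n x c)
include T

theorem adm_pow (l : ℕ) : Adm (n * 2 ^ l) c := by
  induction l with
  | zero => simpa using T.adm
  | succ l ih =>
    have := ih.doubles (T.doubles l)
    rwa [show n * 2 ^ (l + 1) = 2 * (n * 2 ^ l) by ring]

theorem len_pos (l : ℕ) : 0 < n * 2 ^ l := (T.adm_pow l).pos

theorem lt_len (l : ℕ) : l < n * 2 ^ l := by
  have h1 : l < 2 ^ l := Nat.lt_two_pow_self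
  have := T.adm.pos
  nlinarith

/-- The position `k` lies inside the admissible prefix of length `n * 2 ^ k`, which is followed by
its reflection up to the last digit. -/
theorem shift_lt {k : ℕ} (hk : 0 < k) : SeqLT (shift k c) c :=
  (T.adm_pow k).shift_lt (fun _ _ => rfl) (fun j hj => (T.doubles k).1 j (by omega)) hk
    (T.lt_len k)

theorem reflect_lt_shift (k : ℕ) : SeqLT (reflectSeq c) (shift k c) :=
  (T.adm_pow k).reflect_lt_shift (fun _ _ => rfl) (T.lt_len k)

theorem periodic_lt : SeqLT x c :=
  ⟨n - 1, T.agree, by rw [Fin.lt_def]; have := T.incr; omega⟩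

theorem eq_of_agree {y : ℕ → Fin (m + 1)} (h : ∀ N, ∃ l, N ≤ l ∧ AgreeOn (n * 2 ^ l) y c) :
    y = c := by
  funext i
  obtain ⟨l, hl, hy⟩ := h i
  exact hy i (hl.trans_lt (T.lt_len l))

/-- A sequence other than `c` has a longest prefix among the words `c_ℓ`. -/
theorem exists_max {y : ℕ → Fin (m + 1)} {k : ℕ} (hk : AgreeOn (n * 2 ^ k) y c) (hne : y ≠ c) :
    ∃ l, k ≤ l ∧ AgreeOn (n * 2 ^ l) y c ∧ ¬ AgreeOn (2 * (n * 2 ^ l)) y c := by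
  by_contra! hcon
  refine hne (T.eq_of_agree fun N => ?_)
  have : ∀ N, AgreeOn (n * 2 ^ (k + N)) y c := by
    intro N
    induction N with
    | zero => exact hk
    | succ N ih =>
      have := hcon _ (by omega) ih
      rwa [show n * 2 ^ (k + (N + 1)) = 2 * (n * 2 ^ (k + N)) by ring]
  exact ⟨k + N, by omega, this N⟩

/-- A sequence between `x` and `c` starts with one of the words `c₀⁻`, `c₀`. -/
theorem first_block {y : ℕ → Fin (m + 1)} (hx : ¬ SeqLT y x) (hc : SeqLT y c) :
    AgreeOn n y x ∨ AgreeOn n y c := by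
  have hn := T.adm.pos
  obtain ⟨k, hk1, hk2⟩ := hc
  by_cases hkn : n ≤ k
  · exact Or.inr fun j hj => hk1 j (by omega)
  · left
    have hag : AgreeOn k y x := fun j hj => by rw [hk1 j hj, T.agree j (by omega)]
    have hle := hag.symm.le_of_lt hx
    have hlast : k = n - 1 := by
      by_contra hne
      rw [T.agree k (by omega)] at hle
      exact absurd hk2 (not_lt.2 hle)
    intro j hj
    rcases (show j ≤ k by omega).lt_or_eq with hjk | rfl
    · exact hag j hjk
    · have := T.incr
      rw [← hlast] at this
      rw [Fin.le_def] at hle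
      rw [Fin.lt_def] at hk2
      rw [Fin.ext_iff]; omega

/-- No sequence strictly between `x` and `c` is the expansion of `1` in a univoque base. -/
theorem gap {e : ℕ → Fin (m + 1)} (hx : SeqLT x e) (hc : SeqLT e c)
    (hu : ∀ k, ¬ SeqLT e (shift k e)) (hl : ∀ k, SeqLT (reflectSeq e) (shift k e)) : False := by
  have hn := T.adm.pos
  rcases T.first_block hx.asymm hc with hf | hf
  · obtain ⟨k, hk1, hk2⟩ := hx
    have hkn : n ≤ k := by
      by_contra hkn
      exact hk2.ne (hf k (by omega)).symm
    -- As `e` follows `x` up to position `k` and then exceeds it, removing one period gives a tail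
    -- that exceeds `e` at position `k - n`.
    refine hu n ⟨k - n, fun j hj => ?_, ?_⟩
    · rw [shift_apply, ← hk1 _ (by omega), ← hk1 _ (by omega), T.periodic]
    · have := T.periodic (k - n)
      rw [show n + (k - n) = k by omega] at this
      rw [shift_apply, show n + (k - n) = k by omega, ← hk1 _ (by omega), ← this]
      exact hk2
  · obtain ⟨l, -, hl1, hl2⟩ := T.exists_max (k := 0) (by simpa using hf)
      (fun h => SeqLT.irrefl c (by rwa [h] at hc))
    set L := n * 2 ^ l with hL
    have hLpos : 0 < L := T.len_pos l
    -- By maximality of `l`, the block `c_l` at the beginning of `e` must be followed by its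
    -- reflection.
    have hnext : AgreeOn L (shift L e) (reflectSeq c) :=
      ((T.doubles l).next_block hLpos hl1 hc (hc.reflect.trans (hl L))).resolve_right hl2
    have hrefl : AgreeOn L (shift L e) (reflectSeq e) := hnext.trans hl1.symm.reflect
    -- the first place where `e` stops being invariant under the twisted shift
    by_cases hex : ∃ t, e (L + t) ≠ (e t).rev
    · classical
      obtain ⟨t, ht, hmin⟩ : ∃ t, e (L + t) ≠ (e t).rev ∧ ∀ j < t, e (L + j) = (e j).rev :=
        ⟨Nat.find hex, Nat.find_spec hex, fun j hj => not_not.1 (Nat.find_min hex hj)⟩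
      have htL : L ≤ t := by
        by_contra htL
        exact ht (hrefl t (by omega))
      have hgt : (e t).rev < e (L + t) := by
        refine lt_of_le_of_ne ?_ (Ne.symm ht)
        have : AgreeOn t (reflectSeq e) (shift L e) := fun j hj => (hmin j hj).symm
        simpa using this.le_of_lt (hl L).asymm
      -- Two twisted shifts cancel the reflection: the tail from `2 * L` repeats `e` up to position
      -- `t - L` and exceeds it there.
      refine hu (2 * L) ⟨t - L, fun j hj => ?_, ?_⟩
      · rw [shift_apply, show 2 * L + j = L + (L + j) by omega, hmin _ (by omega),
          hmin _ (by omega), Fin.rev_rev]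
      · have := hmin (t - L) (by omega)
        rw [show L + (t - L) = t by omega] at this
        rw [shift_apply, show 2 * L + (t - L) = L + t by omega]
        rwa [this, Fin.rev_rev] at hgt
    · push Not at hex
      exact SeqLT.irrefl (reflectSeq e) ((show shift L e = reflectSeq e from funext hex) ▸ hl L)

end Tower

/-! ### Values of expansions -/

/-- The number with the `q`-expansion `x`. -/
noncomputable def val (q : ℝ) (x : ℕ → Fin (m + 1)) : ℝ :=
  ∑' i : ℕ, ((x i : ℕ) : ℝ) / q ^ (i + 1)

theorem digit_le (a : Fin (m + 1)) : ((a : ℕ) : ℝ) ≤ m := by exact_mod_cast Fin.is_le a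

theorem hasSum_const_digit {q : ℝ} (hq : 1 < q) (r : ℝ) :
    HasSum (fun i : ℕ => r / q ^ (i + 1)) (r / (q - 1)) := by
  have h := (hasSum_geometric_of_lt_one (inv_nonneg.2 (by linarith)) (inv_lt_one_of_one_lt₀ hq)).mul_left (r / q)
  have h1 : q - 1 ≠ 0 := by linarith
  have h0 : q ≠ 0 := by linarith
  have e1 : (fun i : ℕ => r / q ^ (i + 1)) = fun i => r / q * q⁻¹ ^ i := by
    funext i; rw [inv_pow, pow_succ]; field_simp
  have e2 : r / (q - 1) = r / q * (1 - q⁻¹)⁻¹ := by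
    have : 1 - q⁻¹ = (q - 1) / q := by field_simp
    rw [this, inv_div]; field_simp
  rw [e1, e2]
  exact h

theorem summable_digits {q : ℝ} (hq : 1 < q) (x : ℕ → Fin (m + 1)) :
    Summable fun i : ℕ => ((x i : ℕ) : ℝ) / q ^ (i + 1) := by
  refine Summable.of_nonneg_of_le (fun i => by positivity) (fun i => ?_)
    (hasSum_const_digit hq m).summable
  have := digit_le (x i)
  gcongr

theorem isExpansion_iff {q : ℝ} (hq : 1 < q) {y : ℝ} {x : ℕ → Fin (m + 1)} :
    IsExpansion q y x ↔ val q x = y :=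
  ⟨fun h => h.tsum_eq, fun h => h ▸ (summable_digits hq x).hasSum⟩

theorem val_nonneg {q : ℝ} (hq : 1 < q) (x : ℕ → Fin (m + 1)) : 0 ≤ val q x :=
  tsum_nonneg fun i => by positivity

theorem val_le {q : ℝ} (hq : 1 < q) (x : ℕ → Fin (m + 1)) : val q x ≤ m / (q - 1) := by
  refine hasSum_le (fun i => ?_) (summable_digits hq x).hasSum (hasSum_const_digit hq m)
  have := digit_le (x i)
  gcongr

theorem val_pos {q : ℝ} (hq : 1 < q) {x : ℕ → Fin (m + 1)} {k : ℕ} (hk : x k ≠ 0) :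
    0 < val q x := by
  refine (summable_digits hq x).tsum_pos (fun i => by positivity) k ?_
  have : 0 < ((x k : ℕ) : ℝ) := by
    exact_mod_cast Nat.pos_of_ne_zero fun h => hk (Fin.ext h)
  positivity

theorem val_reflect {q : ℝ} (hq : 1 < q) (x : ℕ → Fin (m + 1)) :
    val q (reflectSeq x) = m / (q - 1) - val q x := by
  refine HasSum.tsum_eq ?_
  refine ((hasSum_const_digit hq m).sub (summable_digits hq x).hasSum).congr_fun fun i => ?_
  rw [← sub_div, reflectSeq_apply, Fin.val_rev]
  congr 1
  have := Fin.is_le (x i)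
  push_cast [show m + 1 - ((x i : ℕ) + 1) = m - (x i : ℕ) by omega, Nat.cast_sub this]
  ring

theorem val_split {q : ℝ} (hq : 1 < q) (x : ℕ → Fin (m + 1)) (k : ℕ) :
    val q x = (∑ i ∈ Finset.range k, ((x i : ℕ) : ℝ) / q ^ (i + 1)) +
      val q (shift k x) / q ^ k := by
  rw [val, ← (summable_digits hq x).sum_add_tsum_nat_add k, val, ← tsum_div_const]
  congr 2
  funext i
  rw [shift_apply, Nat.add_comm i k, div_div, ← pow_add, show i + 1 + k = k + i + 1 by ring]

theorem val_succ {q : ℝ} (hq : 1 < q) (x : ℕ → Fin (m + 1)) (k : ℕ) :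
    val q (shift k x) = (((x k : ℕ) : ℝ) + val q (shift (k + 1) x)) / q := by
  rw [val_split hq (shift k x) 1, shift_shift]
  simp [add_div]

/-- Comparison of the values of two sequences with a common prefix. -/
theorem val_sub_val {q : ℝ} (hq : 1 < q) {x y : ℕ → Fin (m + 1)} {k : ℕ} (h : AgreeOn k x y) :
    val q x - val q y = (((x k : ℕ) : ℝ) + val q (shift (k + 1) x) -
      (((y k : ℕ) : ℝ) + val q (shift (k + 1) y))) / q ^ (k + 1) := by
  have hs : (∑ i ∈ Finset.range k, ((x i : ℕ) : ℝ) / q ^ (i + 1)) =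
      ∑ i ∈ Finset.range k, ((y i : ℕ) : ℝ) / q ^ (i + 1) :=
    Finset.sum_congr rfl fun i hi => by rw [h i (Finset.mem_range.1 hi)]
  have : q ≠ 0 := by linarith
  rw [val_split hq x k, val_split hq y k, hs, val_succ hq x, val_succ hq y, pow_succ]
  field_simp
  ring

theorem val_lt_of_base_lt {q r : ℝ} (hq : 1 < q) (hqr : q < r) {x : ℕ → Fin (m + 1)} {k : ℕ}
    (hk : x k ≠ 0) : val r x < val q x := by
  have hpos : 0 < ((x k : ℕ) : ℝ) := by
    exact_mod_cast Nat.pos_of_ne_zero fun h => hk (Fin.ext h)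
  refine Summable.tsum_lt_tsum (i := k) (fun i => ?_) ?_ (summable_digits (hq.trans hqr) x)
    (summable_digits hq x)
  · gcongr
  · gcongr

/-- The sequence has infinitely many nonzero digits. -/
def InfNonzero (x : ℕ → Fin (m + 1)) : Prop := ∀ k, ∃ j, k ≤ j ∧ x j ≠ 0

theorem InfNonzero.shift {x : ℕ → Fin (m + 1)} (h : InfNonzero x) (k : ℕ) :
    InfNonzero (shift k x) := by
  intro l
  obtain ⟨j, hj, hx⟩ := h (k + l)
  exact ⟨j - k, by omega, by rwa [shift_apply, show k + (j - k) = j by omega]⟩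

theorem InfNonzero.val_pos {x : ℕ → Fin (m + 1)} (h : InfNonzero x) {q : ℝ} (hq : 1 < q) :
    0 < val q x := by
  obtain ⟨k, -, hk⟩ := h 0
  exact QExpansion.val_pos hq hk

theorem InfNonzero.isInfinite {x : ℕ → Fin (m + 1)} (h : InfNonzero x) : IsInfinite x := by
  rintro ⟨i, -, hi⟩
  obtain ⟨j, hj, hx⟩ := h (i + 1)
  exact hx (hi j hj)

/-- The zero sequence is infinite in the sense of `IsInfinite`; one nonzero digit excludes it. -/
theorem infNonzero_of_isInfinite {x : ℕ → Fin (m + 1)} (h : IsInfinite x) {k : ℕ}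
    (hk : x k ≠ 0) : InfNonzero x := by
  intro l
  induction l with
  | zero => exact ⟨k, Nat.zero_le _, hk⟩
  | succ l ih =>
    obtain ⟨j, hj, hx⟩ := ih
    by_contra! hcon
    exact h ⟨j, hx, fun i hi => hcon i (by omega)⟩

/-- The sequence `x` followed, after its first `k` digits, by `y`. -/
def splice (k : ℕ) (x y : ℕ → Fin (m + 1)) : ℕ → Fin (m + 1) :=
  fun i => if i < k then x i else y (i - k)

theorem splice_agree (k : ℕ) (x y : ℕ → Fin (m + 1)) : AgreeOn k (splice k x y) x :=
  fun j hj => by simp [splice, hj]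

theorem shift_splice (k : ℕ) (x y : ℕ → Fin (m + 1)) : shift k (splice k x y) = y := by
  funext i; simp [splice]

theorem InfNonzero.splice {y : ℕ → Fin (m + 1)} (h : InfNonzero y) (k : ℕ)
    (x : ℕ → Fin (m + 1)) : InfNonzero (splice k x y) := by
  intro l
  obtain ⟨j, hj, hx⟩ := h l
  refine ⟨k + j, by omega, ?_⟩
  simpa [QExpansion.splice] using hx

/-! ### Quasi-greedy expansions -/

theorem one_le_div {q : ℝ} (hq : 1 < q) (hqm : q ≤ m + 1) : 1 ≤ (m : ℝ) / (q - 1) := by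
  rw [le_div_iff₀ (by linarith)]; linarith

/-- The quasi-greedy digit of `y`. -/
theorem exists_digit {q : ℝ} (hq : 1 < q) (hqm : q ≤ m + 1) {y : ℝ} (hy : 0 < y)
    (hym : y ≤ m / (q - 1)) :
    ∃ d : Fin (m + 1), 0 < q * y - ((d : ℕ) : ℝ) ∧ q * y - ((d : ℕ) : ℝ) ≤ m / (q - 1) ∧
      (d < Fin.last m → q * y - ((d : ℕ) : ℝ) ≤ 1) := by
  have hqy : 0 < q * y := by positivity
  -- The digit is the minimum of `⌈q y⌉ - 1` and `m`, the largest one that leaves a positive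
  -- remainder.
  have hceil : 0 < ⌈q * y⌉₊ := Nat.ceil_pos.2 hqy
  have hlt : ((⌈q * y⌉₊ - 1 : ℕ) : ℝ) < q * y := by
    rw [← Nat.lt_ceil]; omega
  have hle : q * y ≤ ((⌈q * y⌉₊ - 1 : ℕ) : ℝ) + 1 := by
    have := Nat.le_ceil (q * y)
    rw [← Nat.cast_add_one, Nat.sub_add_cancel hceil]
    exact this
  by_cases h : ⌈q * y⌉₊ - 1 < m
  · refine ⟨⟨⌈q * y⌉₊ - 1, by omega⟩, by simpa using hlt, ?_, fun _ => ?_⟩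
    · have := one_le_div hq hqm
      simp only; linarith
    · simp only; linarith
  · have h1 : (m : ℝ) ≤ ((⌈q * y⌉₊ - 1 : ℕ) : ℝ) := by exact_mod_cast not_lt.1 h
    refine ⟨Fin.last m, ?_, ?_, fun h => absurd h (lt_irrefl _)⟩
    · simp only [Fin.val_last]; linarith
    · simp only [Fin.val_last]
      have : q * y ≤ q * (m / (q - 1)) := by gcongr
      have e : q * ((m : ℝ) / (q - 1)) = m + m / (q - 1) := by
        have : q - 1 ≠ 0 := by linarith
        field_simp; ring
      linarith

/-- The quasi-greedy algorithm: the remainders `r (k + 1) = q * r k - d_k` stay in `(0, m / (q -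
1)]`. Boundedness makes the series converge to `y`, positivity excludes a tail of zeros, and a digit
below `m` leaves a remainder at most `1`. -/
theorem exists_quasiGreedy {q : ℝ} (hq : 1 < q) (hqm : q ≤ m + 1) {y : ℝ} (hy : 0 < y)
    (hym : y ≤ m / (q - 1)) :
    ∃ x : ℕ → Fin (m + 1), val q x = y ∧ InfNonzero x ∧
      ∀ k, x k < Fin.last m → val q (shift (k + 1) x) ≤ 1 := by
  choose! f hf1 hf2 hf3 using fun (y : ℝ) (h : 0 < y ∧ y ≤ m / (q - 1)) =>
    exists_digit hq hqm h.1 h.2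
  let r : ℕ → ℝ := fun k => Nat.rec y (fun _ z => q * z - ((f z : ℕ) : ℝ)) k
  have hr : ∀ k, r (k + 1) = q * r k - ((f (r k) : ℕ) : ℝ) := fun k => rfl
  have hrm : ∀ k, 0 < r k ∧ r k ≤ m / (q - 1) := by
    intro k
    induction k with
    | zero => exact ⟨hy, hym⟩
    | succ k ih => rw [hr]; exact ⟨hf1 _ ih, hf2 _ ih⟩
  let x : ℕ → Fin (m + 1) := fun k => f (r k)
  have hq0 : 0 < q := by linarith
  have hpart : ∀ k N, r k = (∑ i ∈ Finset.range N, ((shift k x i : ℕ) : ℝ) / q ^ (i + 1)) +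
      r (k + N) / q ^ N := by
    intro k N
    induction N with
    | zero => simp
    | succ N ih =>
      rw [Finset.sum_range_succ, ih, ← Nat.add_assoc k N 1, hr, shift_apply, pow_succ]
      simp only [x]
      field_simp
      ring
  have hval : ∀ k, val q (shift k x) = r k := by
    intro k
    refine HasSum.tsum_eq ((hasSum_iff_tendsto_nat_of_nonneg (fun i => by positivity) _).2 ?_)
    have h0 : Filter.Tendsto (fun N => r (k + N) / q ^ N) Filter.atTop (nhds 0) := by
      have hg : Filter.Tendsto (fun N : ℕ => (m / (q - 1)) / q ^ N) Filter.atTop (nhds 0) :=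
        (tendsto_pow_atTop_atTop_of_one_lt hq).const_div_atTop _
      refine squeeze_zero (fun N => ?_) (fun N => ?_) hg
      · have := (hrm (k + N)).1; positivity
      · have := (hrm (k + N)).2; gcongr
    have h1 := (tendsto_const_nhds (x := r k)).sub h0
    rw [sub_zero] at h1
    refine h1.congr fun N => ?_
    rw [hpart k N]; ring
  refine ⟨x, by rw [← shift_zero x]; exact hval 0, fun k => ?_, fun k hk => ?_⟩
  · by_contra! hcon
    have h0 : val q (shift k x) = 0 := by
      have : shift k x = fun _ => 0 := funext fun i => hcon (k + i) (by omega)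
      rw [this]; simp [val]
    exact (hrm k).1.ne' (hval k ▸ h0)
  · rw [hval, hr]; exact hf3 _ (hrm k) hk

theorem exists_expansion {q : ℝ} (hq : 1 < q) (hqm : q ≤ m + 1) {y : ℝ} (hy : 0 ≤ y)
    (hym : y ≤ m / (q - 1)) : ∃ x : ℕ → Fin (m + 1), val q x = y := by
  rcases hy.eq_or_lt with rfl | hy
  · exact ⟨fun _ => 0, by simp [val]⟩
  · obtain ⟨x, hx, -⟩ := exists_quasiGreedy hq hqm hy hym
    exact ⟨x, hx⟩

/-- A characterization of the quasi-greedy expansion `α` of `1` in base `q`. -/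
structure Good (q : ℝ) (α : ℕ → Fin (m + 1)) : Prop where
  val_eq : val q α = 1
  inf : InfNonzero α
  tail : ∀ k, α k < Fin.last m → val q (shift (k + 1) α) ≤ 1

theorem exists_good {q : ℝ} (hq : 1 < q) (hqm : q ≤ m + 1) :
    ∃ α : ℕ → Fin (m + 1), Good q α := by
  obtain ⟨x, h1, h2, h3⟩ := exists_quasiGreedy hq hqm one_pos (one_le_div hq hqm)
  exact ⟨x, h1, h2, h3⟩

/-- At the first difference `x` gains at least `1`, which outweighs the following tail of `α`, of
value at most `1`. -/
theorem Good.one_le_val {q : ℝ} (hq : 1 < q) {α x : ℕ → Fin (m + 1)} (h : Good q α)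
    (hx : SeqLT α x) : 1 ≤ val q x := by
  obtain ⟨k, hk1, hk2⟩ := hx
  have h1 := val_sub_val hq (show AgreeOn k x α from AgreeOn.symm hk1)
  have h2 := h.tail k (hk2.trans_le (Fin.le_last _))
  have h3 := val_nonneg hq (shift (k + 1) x)
  have h4 : ((α k : ℕ) : ℝ) + 1 ≤ ((x k : ℕ) : ℝ) := by exact_mod_cast hk2
  have h5 : 0 ≤ val q x - val q α := by
    rw [h1]
    exact div_nonneg (by linarith) (by positivity)
  rw [h.val_eq] at h5
  linarith

theorem Good.one_lt_val {q : ℝ} (hq : 1 < q) {α x : ℕ → Fin (m + 1)} (h : Good q α)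
    (hx : SeqLT α x) (hinf : InfNonzero x) : 1 < val q x := by
  obtain ⟨k, hk1, hk2⟩ := hx
  have h1 := val_sub_val hq (show AgreeOn k x α from AgreeOn.symm hk1)
  have h2 := h.tail k (hk2.trans_le (Fin.le_last _))
  have h3 := (hinf.shift (k + 1)).val_pos hq
  have h4 : ((α k : ℕ) : ℝ) + 1 ≤ ((x k : ℕ) : ℝ) := by exact_mod_cast hk2
  have h5 : 0 < val q x - val q α := by
    rw [h1]
    exact div_pos (by linarith) (by positivity)
  rw [h.val_eq] at h5
  linarith

/-- If `α` were smaller than its first tail, its digits would be constant up to the first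
difference, and this constant would be less than `m`. The tail bound after the digit `α 0` then
applies. -/
theorem Good.shift_one_le {q : ℝ} (hq : 1 < q) {α : ℕ → Fin (m + 1)} (h : Good q α) :
    ¬ SeqLT α (shift 1 α) := by
  intro hlt
  obtain ⟨l, hl1, hl2⟩ := id hlt
  have hconst : ∀ j ≤ l, α j = α 0 := by
    intro j
    induction j with
    | zero => exact fun _ => rfl
    | succ j ihj =>
      intro hj
      have e := hl1 j (by omega)
      rw [shift_apply, Nat.add_comm 1 j] at e
      rw [← e, ihj (by omega)]
  have h0 : α 0 < Fin.last m := by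
    rw [← hconst l le_rfl]
    exact hl2.trans_le (Fin.le_last _)
  exact absurd (h.one_lt_val hq hlt (h.inf.shift 1)) (not_lt.2 (h.tail 0 h0))

/-- After a digit below `m` the tail has value at most `1`, whereas a sequence above `α` with
infinitely many nonzero digits has value above `1`. A preceding digit `m` can be restored in front
of the tail, which moves the claim one place to the left. -/
theorem Good.shift_le {q : ℝ} (hq : 1 < q) {α : ℕ → Fin (m + 1)} (h : Good q α) (k : ℕ) :
    ¬ SeqLT α (shift k α) := by
  induction k with
  | zero => simpa using SeqLT.irrefl α
  | succ k ih =>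
    intro hlt
    by_cases hk : α k < Fin.last m
    · exact absurd (h.one_lt_val hq hlt (h.inf.shift _)) (not_lt.2 (h.tail k hk))
    · have hk' : α k = Fin.last m := le_antisymm (Fin.le_last _) (not_lt.1 hk)
      have hlt' : SeqLT (shift 1 α) (shift (k + 1) α) := by
        rcases seqLT_trichotomy (shift 1 α) α with h1 | h1 | h1
        · exact h1.trans hlt
        · rwa [h1]
        · exact absurd h1 (h.shift_one_le hq)
      obtain ⟨l, hl1, hl2⟩ := hlt'
      rcases (Fin.le_last (α 0)).lt_or_eq with h0 | h0
      · exact ih ⟨0, by simp, by simpa [hk'] using h0⟩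
      · refine ih ⟨l + 1, fun j hj => ?_, ?_⟩
        · rcases Nat.eq_zero_or_pos j with rfl | hj0
          · simp [h0, hk']
          · have := hl1 (j - 1) (by omega)
            simpa [show 1 + (j - 1) = j by omega, show k + 1 + (j - 1) = k + j by omega] using this
        · simpa [show k + (l + 1) = k + 1 + l by omega, Nat.add_comm 1 l] using hl2

/-- A lexicographic condition which bounds the values of tails. -/
theorem val_shift_le {q : ℝ} (hq : 1 < q) {α d : ℕ → Fin (m + 1)} (hα : val q α = 1)
    (hd : ∀ n, d n < Fin.last m → ¬ SeqLT α (shift (n + 1) d)) {n : ℕ}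
    (hn : d n < Fin.last m) : val q (shift (n + 1) d) ≤ 1 := by
  -- The excess over `1` is estimated for all positions at once. At the first difference from `α`
  -- the digit of `d` is smaller by at least one, so the excess is at most that of a later tail
  -- divided by a positive power of `q`. Iteration shows that it is not positive.
  have key : ∀ N n, d n < Fin.last m →
      val q (shift (n + 1) d) - 1 ≤ (m / (q - 1)) / q ^ N := by
    intro N
    induction N with
    | zero =>
      intro n _
      have := val_le hq (shift (n + 1) d)
      simp only [pow_zero, div_one]; linarith
    | succ N ih =>
      intro n hn
      have hnn : 0 ≤ (m : ℝ) / (q - 1) := div_nonneg (by positivity) (by linarith)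
      rcases seqLT_trichotomy (shift (n + 1) d) α with h | h | h
      · obtain ⟨k, hk1, hk2⟩ := h
        have h1 := val_sub_val hq hk1
        rw [hα, shift_shift, shift_apply] at h1
        rw [h1, pow_succ q k, pow_succ q N, ← div_div, ← div_div _ (q ^ N)]
        have h2 : ((d (n + 1 + k) : ℕ) : ℝ) + 1 ≤ ((α k : ℕ) : ℝ) := by exact_mod_cast hk2
        have h3 := val_nonneg hq (shift (k + 1) α)
        have h4 := ih (n + 1 + k) (hk2.trans_le (Fin.le_last _))
        rw [show n + 1 + k + 1 = n + 1 + (k + 1) by ring] at h4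
        have h5 : ((d (n + 1 + k) : ℕ) : ℝ) + val q (shift (n + 1 + (k + 1)) d) -
          (((α k : ℕ) : ℝ) + val q (shift (k + 1) α)) ≤ m / (q - 1) / q ^ N := by linarith
        have h6 : m / (q - 1) / q ^ N / q ^ k ≤ m / (q - 1) / q ^ N :=
          div_le_self (by positivity) (one_le_pow₀ hq.le)
        exact div_le_div_of_nonneg_right
          ((div_le_div_of_nonneg_right h5 (by positivity)).trans h6) (by linarith)
      · rw [h, hα, sub_self]; positivity
      · exact absurd h (hd n hn)
  have h0 : Filter.Tendsto (fun N : ℕ => (m / (q - 1) : ℝ) / q ^ N) Filter.atTop (nhds 0) :=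
    (tendsto_pow_atTop_atTop_of_one_lt hq).const_div_atTop _
  have := ge_of_tendsto' h0 fun N => key N n hn
  linarith

theorem val_shift_lt {q : ℝ} (hq : 1 < q) {α d : ℕ → Fin (m + 1)} (hα : val q α = 1)
    (hinf : InfNonzero α) (hd : ∀ n, d n < Fin.last m → SeqLT (shift (n + 1) d) α) {n : ℕ}
    (hn : d n < Fin.last m) : val q (shift (n + 1) d) < 1 := by
  obtain ⟨k, hk1, hk2⟩ := hd n hn
  have h1 := val_sub_val hq hk1
  rw [hα, shift_shift, shift_apply] at h1
  have h2 : ((d (n + 1 + k) : ℕ) : ℝ) + 1 ≤ ((α k : ℕ) : ℝ) := by exact_mod_cast hk2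
  have h3 := (hinf.shift (k + 1)).val_pos hq
  have h4 := val_shift_le hq hα (fun n hn => (hd n hn).asymm)
    (n := n + 1 + k) (hk2.trans_le (Fin.le_last _))
  rw [show n + 1 + k + 1 = n + 1 + (k + 1) by ring] at h4
  have h5 : val q (shift (n + 1) d) - 1 < 0 := by
    rw [h1]
    exact div_neg_of_neg_of_pos (by linarith) (by positivity)
  linarith

theorem good_of_shift_le {q : ℝ} (hq : 1 < q) {α : ℕ → Fin (m + 1)} (hα : val q α = 1)
    (hinf : InfNonzero α) (h : ∀ k, ¬ SeqLT α (shift k α)) : Good q α :=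
  ⟨hα, hinf, fun _ hk => val_shift_le hq hα (fun _ _ => h _) hk⟩

/-- If a tail after a digit below `m` had value above `1`, that digit could be raised and the
positive rest expanded by the quasi-greedy algorithm. The result would be a larger infinite
expansion of `1`. -/
theorem IsQuasiGreedy.good {q : ℝ} (hq : 1 < q) (hqm : q ≤ m + 1) {α : ℕ → Fin (m + 1)}
    (h : IsQuasiGreedy q 1 α) : Good q α := by
  obtain ⟨h1, h2, h3⟩ := h
  rw [isExpansion_iff hq] at h1
  have hex : ∃ k, α k ≠ 0 := by
    by_contra! hcon
    rw [show α = fun _ => 0 from funext hcon] at h1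
    simp [val] at h1
  obtain ⟨k₀, hk₀⟩ := hex
  refine ⟨h1, infNonzero_of_isInfinite h2 hk₀, fun k hk => ?_⟩
  by_contra! hgt
  have hle := val_le hq (shift (k + 1) α)
  obtain ⟨t, ht1, ht2, -⟩ := exists_quasiGreedy hq hqm
    (y := val q (shift (k + 1) α) - 1) (by linarith) (by linarith)
  have hk' : (α k : ℕ) < m := hk
  let e : Fin (m + 1) := ⟨α k + 1, by omega⟩
  let d := splice (k + 1) (fun i => if i = k then e else α i) t
  have hag : AgreeOn k d α := fun j hj => by
    simp [d, splice, hj.ne, show j < k + 1 by omega]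
  have hdk : d k = e := by simp [d, splice]
  have hlt : α k < e := by rw [Fin.lt_def]; simp [e]
  have hval : val q d = 1 := by
    have := val_sub_val hq hag
    rw [hdk, h1, show shift (k + 1) d = t from shift_splice _ _ _, ht1] at this
    simp only [e] at this
    push_cast at this
    rw [show ((α k : ℕ) : ℝ) + 1 + (val q (shift (k + 1) α) - 1) -
      (((α k : ℕ) : ℝ) + val q (shift (k + 1) α)) = 0 by ring, zero_div] at this
    linarith
  have := h3 d ((isExpansion_iff hq).2 hval) (ht2.splice _ _).isInfinite
  refine absurd this (not_le.2 ?_)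
  exact ⟨k, fun j hj => (hag j hj).symm, by simpa [hdk] using hlt⟩

/-! ### Unique expansions -/

theorem mem_univoqueSeqs_iff_unique {q : ℝ} (hq : 1 < q) {b : ℕ → Fin (m + 1)} :
    b ∈ univoqueSeqs m q ↔ ∀ d, val q d = val q b → d = b := by
  constructor
  · rintro ⟨x, ⟨-, c, hc, hu⟩, hb⟩ d hd
    rw [isExpansion_iff hq] at hb
    rw [hu d ((isExpansion_iff hq).2 (hd.trans hb)), hu b ((isExpansion_iff hq).2 hb)]
  · intro h
    have hb : IsExpansion q (val q b) b := (isExpansion_iff hq).2 rfl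
    exact ⟨val q b, ⟨⟨val_nonneg hq b, val_le hq b⟩, b, hb,
      fun d hd => h d ((isExpansion_iff hq).1 hd)⟩, hb⟩

theorem reflect_mem_univoqueSeqs {q : ℝ} (hq : 1 < q) {b : ℕ → Fin (m + 1)} :
    reflectSeq b ∈ univoqueSeqs m q ↔ b ∈ univoqueSeqs m q := by
  have key : ∀ b : ℕ → Fin (m + 1), b ∈ univoqueSeqs m q → reflectSeq b ∈ univoqueSeqs m q := by
    intro b hb
    rw [mem_univoqueSeqs_iff_unique hq] at hb ⊢
    intro d hd
    rw [← hb (reflectSeq d) (by rw [val_reflect hq, hd, val_reflect hq]; ring),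
      reflectSeq_reflectSeq]
  exact ⟨fun h => reflectSeq_reflectSeq b ▸ key _ h, key b⟩

/-- The lexicographic condition on tails which follow a digit less than `m`. -/
def UpperCond (α b : ℕ → Fin (m + 1)) : Prop :=
  ∀ n, b n < Fin.last m → SeqLT (shift (n + 1) b) α

/-- A tail of value at least `1` after a digit below `m` would allow a second expansion with this
digit raised. So the value is below `1`, while sequences not smaller than `α` have value at least
`1`. -/
theorem upperCond_of_mem {q : ℝ} (hq : 1 < q) (hqm : q ≤ m + 1) {α b : ℕ → Fin (m + 1)}
    (hα : Good q α) (hb : b ∈ univoqueSeqs m q) : UpperCond α b := by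
  intro n hn
  rw [mem_univoqueSeqs_iff_unique hq] at hb
  have hlt : val q (shift (n + 1) b) < 1 := by
    by_contra! hge
    have hle := val_le hq (shift (n + 1) b)
    obtain ⟨t, ht⟩ := exists_expansion hq hqm (y := val q (shift (n + 1) b) - 1)
      (by linarith) (by linarith)
    have hn' : (b n : ℕ) < m := hn
    let e : Fin (m + 1) := ⟨b n + 1, by omega⟩
    let d := splice (n + 1) (fun i => if i = n then e else b i) t
    have hag : AgreeOn n d b := fun j hj => by
      simp [d, splice, hj.ne, show j < n + 1 by omega]
    have hdn : d n = e := by simp [d, splice]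
    have hval : val q d = val q b := by
      have := val_sub_val hq hag
      rw [hdn, show shift (n + 1) d = t from shift_splice _ _ _, ht] at this
      simp only [e] at this
      push_cast at this
      rw [show ((b n : ℕ) : ℝ) + 1 + (val q (shift (n + 1) b) - 1) -
        (((b n : ℕ) : ℝ) + val q (shift (n + 1) b)) = 0 by ring, zero_div] at this
      linarith
    have h1 := congrFun (hb d hval) n
    rw [hdn] at h1
    have h2 := congrArg Fin.val h1
    simp [e] at h2
  rcases seqLT_trichotomy (shift (n + 1) b) α with h | h | h
  · exact h
  · rw [h, hα.val_eq] at hlt; exact absurd hlt (lt_irrefl _)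
  · exact absurd hlt (not_lt.2 (hα.one_le_val hq h))

/-- A larger expansion of the same number would gain at least `1` at the first difference, but the
tail of `b` there has value below `1`. Smaller expansions are excluded by reflection. -/
theorem mem_of_upperCond {q : ℝ} (hq : 1 < q) {α b : ℕ → Fin (m + 1)}
    (hα : Good q α) (h1 : UpperCond α b) (h2 : UpperCond α (reflectSeq b)) :
    b ∈ univoqueSeqs m q := by
  rw [mem_univoqueSeqs_iff_unique hq]
  have key : ∀ b d : ℕ → Fin (m + 1), UpperCond α b → val q d = val q b → ¬ SeqLT b d := by
    rintro b d hb hd ⟨k, hk1, hk2⟩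
    have h3 := val_shift_lt hq hα.val_eq hα.inf hb (hk2.trans_le (Fin.le_last _))
    have h4 := val_sub_val hq (show AgreeOn k d b from AgreeOn.symm hk1)
    have h5 := val_nonneg hq (shift (k + 1) d)
    have h6 : ((b k : ℕ) : ℝ) + 1 ≤ ((d k : ℕ) : ℝ) := by exact_mod_cast hk2
    have h7 : 0 < val q d - val q b := by
      rw [h4]; exact div_pos (by linarith) (by positivity)
    linarith
  intro d hd
  rcases seqLT_trichotomy d b with h | h | h
  · exact absurd h.reflect (key _ _ h2 (by rw [val_reflect hq, hd, val_reflect hq]))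
  · exact h
  · exact absurd h (key _ _ h1 hd)

theorem mem_univoqueSeqs_iff {q : ℝ} (hq : 1 < q) (hqm : q ≤ m + 1) {α b : ℕ → Fin (m + 1)}
    (hα : Good q α) :
    b ∈ univoqueSeqs m q ↔ UpperCond α b ∧ UpperCond α (reflectSeq b) :=
  ⟨fun h => ⟨upperCond_of_mem hq hqm hα h,
    upperCond_of_mem hq hqm hα ((reflect_mem_univoqueSeqs hq).2 h)⟩,
    fun h => mem_of_upperCond hq hα h.1 h.2⟩

/-- The lexicographic condition extends to tails which follow a block other than `m ⋯ m`. -/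
theorem shift_lt_of_forall_lt {α b : ℕ → Fin (m + 1)} (hα : ¬ SeqLT α (shift 1 α)) {l j : ℕ}
    (h : ∀ n < l, b n < Fin.last m → SeqLT (shift (n + 1) b) α) (hj : j < l)
    (hbj : b j < Fin.last m) : SeqLT (shift l b) α := by
  induction l with
  | zero => omega
  | succ l ih =>
    replace ih := ih fun n hn => h n (by omega)
    by_cases hl : b l < Fin.last m
    · exact h l (by omega) hl
    · have hl' : b l = Fin.last m := le_antisymm (Fin.le_last _) (not_lt.1 hl)
      have hjl : j < l := by
        refine lt_of_le_of_ne (by omega) ?_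
        rintro rfl; exact hl hbj
      obtain ⟨k, hk1, hk2⟩ := ih hjl
      -- A tail that starts with `m` and is below `α` shares this digit with `α`. Dropping it leaves
      -- a tail below `shift 1 α`, which does not exceed `α`.
      have hk0 : k ≠ 0 := by
        rintro rfl
        rw [shift_apply, Nat.add_zero l] at hk2
        exact hl (hk2.trans_le (Fin.le_last _))
      have : SeqLT (shift (l + 1) b) (shift 1 α) := by
        refine ⟨k - 1, fun i hi => ?_, ?_⟩
        · have := hk1 (i + 1) (by omega)
          simpa [Nat.add_comm, Nat.add_left_comm] using this
        · simpa [show l + 1 + (k - 1) = l + k by omega, show 1 + (k - 1) = k by omega] using hk2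
      rcases seqLT_trichotomy (shift 1 α) α with h1 | h1 | h1
      · exact this.trans h1
      · rwa [h1] at this
      · exact absurd h1 hα

theorem UpperCond.shift_lt {α b : ℕ → Fin (m + 1)} (h : UpperCond α b)
    (hα : ¬ SeqLT α (shift 1 α)) {l j : ℕ} (hj : j < l) (hbj : b j < Fin.last m) :
    SeqLT (shift l b) α :=
  shift_lt_of_forall_lt hα (fun n _ => h n) hj hbj

/-! ### Dependence on the base -/

theorem Good.lt_of_lt {q r : ℝ} (hq : 1 < q) (hqr : q < r) {α β : ℕ → Fin (m + 1)}
    (hα : Good q α) (hβ : Good r β) : SeqLT α β := by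
  obtain ⟨k, -, hk⟩ := hα.inf 0
  have h1 := val_lt_of_base_lt hq hqr hk
  rw [hα.val_eq] at h1
  rcases seqLT_trichotomy α β with h | h | h
  · exact h
  · rw [h, hβ.val_eq] at h1; exact absurd h1 (lt_irrefl _)
  · exact absurd h1 (not_lt.2 (hβ.one_le_val (hq.trans hqr) h))

/-- Quasi-greedy expansions of `1` are continuous from the left in the base. -/
theorem Good.agree_left {q : ℝ} (hq : 1 < q) {α : ℕ → Fin (m + 1)} (hα : Good q α) (N : ℕ) :
    ∀ᶠ r in nhds q, ∀ β : ℕ → Fin (m + 1), r < q → Good r β → AgreeOn N β α := by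
  -- The first `N` digits of `α` have value strictly below `1`, which persists in nearby bases. If
  -- `β` were smaller than `α` within these digits, their value in base `r` would be at least `1`,
  -- because the tail of `β` after the difference is at most `1`.
  have hlt : (∑ i ∈ Finset.range N, ((α i : ℕ) : ℝ) / q ^ (i + 1)) < 1 := by
    have h1 := val_split hq α N
    have h2 := (hα.inf.shift N).val_pos hq
    rw [hα.val_eq] at h1
    have : 0 < val q (shift N α) / q ^ N := by positivity
    linarith
  have hcont : ContinuousAt
      (fun r : ℝ => ∑ i ∈ Finset.range N, ((α i : ℕ) : ℝ) / r ^ (i + 1)) q := by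
    refine tendsto_finsetSum _ fun i _ => ?_
    exact ContinuousAt.div continuousAt_const (continuousAt_id.pow _)
      (pow_ne_zero _ (by simp; linarith))
  filter_upwards [hcont.eventually_lt continuousAt_const hlt, lt_mem_nhds hq] with r hr hr1
  intro β hrq hβ
  obtain ⟨k, hk1, hk2⟩ := hβ.lt_of_lt hr1 hrq hα
  by_contra hcon
  have hkN : k < N := by
    by_contra hkN
    exact hcon fun j hj => hk1 j (by omega)
  have h1 := val_split hr1 β k
  have h2 := val_succ hr1 β k
  have h3 := hβ.tail k (hk2.trans_le (Fin.le_last _))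
  have h4 : ((β k : ℕ) : ℝ) + 1 ≤ ((α k : ℕ) : ℝ) := by exact_mod_cast hk2
  rw [hβ.val_eq, h2, Finset.sum_congr rfl fun i hi => by rw [hk1 i (Finset.mem_range.1 hi)],
    div_div, ← pow_succ'] at h1
  have h5 : (((β k : ℕ) : ℝ) + val r (shift (k + 1) β)) / r ^ (k + 1) ≤
      ((α k : ℕ) : ℝ) / r ^ (k + 1) := by
    gcongr; linarith
  have h6 : (∑ i ∈ Finset.range (k + 1), ((α i : ℕ) : ℝ) / r ^ (i + 1)) ≤
      ∑ i ∈ Finset.range N, ((α i : ℕ) : ℝ) / r ^ (i + 1) :=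
    Finset.sum_le_sum_of_subset_of_nonneg (Finset.range_subset_range.2 hkN)
      fun i _ _ => by positivity
  rw [Finset.sum_range_succ] at h6
  linarith

theorem continuousOn_val {p : ℝ} (hp : 1 < p) (x : ℕ → Fin (m + 1)) :
    ContinuousOn (fun q => val q x) (Set.Ici p) := by
  refine continuousOn_tsum (u := fun i => (m : ℝ) / p ^ (i + 1)) (fun i => ?_)
    (hasSum_const_digit hp m).summable fun i q hq => ?_
  · refine ContinuousOn.div continuousOn_const (continuousOn_id.pow _) fun q hq => ?_
    have : p ≤ q := hq
    exact pow_ne_zero _ (by simp; linarith)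
  · have hq' : p ≤ q := hq
    have := digit_le (x i)
    have hq0 : 0 < q := by linarith
    rw [Real.norm_of_nonneg (by positivity)]
    gcongr

/-! ### Words -/

theorem rev_lt_last {d : Fin (m + 1)} (h : 0 < d) : d.rev < Fin.last m := by
  simpa using Fin.rev_lt_rev.2 h

theorem length_incrLast (w : List (Fin (m + 1))) : (incrLast w).length = w.length := by
  induction w with
  | nil => rfl
  | cons x t ih =>
    cases t with
    | nil => rfl
    | cons y t => simpa [incrLast] using ih

theorem getD_incrLast (w : List (Fin (m + 1))) {j : ℕ} (hj : j + 1 < w.length) :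
    (incrLast w).getD j 0 = w.getD j 0 := by
  induction w generalizing j with
  | nil => simp at hj
  | cons x t ih =>
    cases t with
    | nil => simp at hj
    | cons y t =>
      cases j with
      | zero => simp [incrLast]
      | succ j => simpa [incrLast] using ih (j := j) (by simpa using hj)

theorem getD_incrLast_last (w : List (Fin (m + 1))) (hw : w ≠ []) :
    (incrLast w).getD (w.length - 1) 0 = w.getD (w.length - 1) 0 + 1 := by
  induction w with
  | nil => exact absurd rfl hw
  | cons x t ih =>
    cases t with
    | nil => simp [incrLast]
    | cons y t => simpa [incrLast] using ih (by simp)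

theorem length_reflect (w : List (Fin (m + 1))) : (reflect w).length = w.length := by
  simp [reflect]

theorem getD_reflect (w : List (Fin (m + 1))) {j : ℕ} (hj : j < w.length) :
    (reflect w).getD j 0 = (w.getD j 0).rev := by
  simp [reflect, List.getD_eq_getElem?_getD, hj]

theorem length_blockWord (a : List (Fin (m + 1))) (l : ℕ) :
    (blockWord a l).length = a.length * 2 ^ l := by
  induction l with
  | zero => simp [blockWord, length_incrLast]
  | succ l ih => simp [blockWord, length_incrLast, length_reflect, ih, pow_succ]; ring

/-- The limit of the words `c_ℓ`. -/
def limitSeq (a : List (Fin (m + 1))) : ℕ → Fin (m + 1) := fun j => (blockWord a j).getD j 0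

theorem getD_blockWord_of_le (a : List (Fin (m + 1))) {k l j : ℕ} (hkl : k ≤ l)
    (hj : j < a.length * 2 ^ k) : (blockWord a l).getD j 0 = (blockWord a k).getD j 0 := by
  induction l, hkl using Nat.le_induction with
  | base => rfl
  | succ l hkl ih =>
    rw [← ih, blockWord, List.getD_append]
    rw [length_blockWord]
    exact hj.trans_le (len_mono _ hkl)

theorem getD_blockWord {a : List (Fin (m + 1))} {l j : ℕ} (hj : j < a.length * 2 ^ l) :
    (blockWord a l).getD j 0 = limitSeq a j := by
  have hj' : j < a.length * 2 ^ j := by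
    have h1 : 0 < a.length := Nat.pos_of_ne_zero fun h => by simp [h] at hj
    have h2 : j < 2 ^ j := Nat.lt_two_pow_self
    nlinarith
  rcases le_total l j with h | h
  · exact (getD_blockWord_of_le a h hj).symm
  · exact getD_blockWord_of_le a h hj'

theorem periodicSeq_add (a : List (Fin (m + 1))) (i : ℕ) :
    periodicSeq a (a.length + i) = periodicSeq a i := by
  simp [periodicSeq]

theorem periodicSeq_of_lt (a : List (Fin (m + 1))) {i : ℕ} (hi : i < a.length) :
    periodicSeq a i = a.getD i 0 := by
  simp [periodicSeq, Nat.mod_eq_of_lt hi]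

theorem limitSeq_agree (a : List (Fin (m + 1))) :
    AgreeOn (a.length - 1) (periodicSeq a) (limitSeq a) := by
  intro j hj
  rw [periodicSeq_of_lt a (by omega), ← getD_blockWord (l := 0) (by omega), blockWord,
    getD_incrLast _ (by omega)]

/-- The bound on the last digit keeps the addition in `Fin (m + 1)` from wrapping around to `0`. -/
theorem limitSeq_incr {a : List (Fin (m + 1))} (ha : a ≠ [])
    (hlast : periodicSeq a (a.length - 1) < Fin.last m) :
    (limitSeq a (a.length - 1) : ℕ) = (periodicSeq a (a.length - 1) : ℕ) + 1 := by
  have hpos := List.length_pos_iff.2 ha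
  rw [periodicSeq_of_lt a (by omega)] at hlast ⊢
  rw [← getD_blockWord (l := 0) (by omega), blockWord, getD_incrLast_last _ ha,
    Fin.val_add_one_of_lt hlast]

/-- The last digit of each `c_ℓ` is positive, since it arises by raising a digit. Its reflection is
therefore below `m` and can be raised without wrapping around. -/
theorem limitSeq_doubles {a : List (Fin (m + 1))} (ha : a ≠ [])
    (hlast : periodicSeq a (a.length - 1) < Fin.last m) (l : ℕ) :
    Doubles (a.length * 2 ^ l) (limitSeq a) := by
  have hpos := List.length_pos_iff.2 ha
  have hne : ∀ l, blockWord a l ≠ [] := fun l => by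
    rw [← List.length_pos_iff, length_blockWord]; positivity
  have key : ∀ l, 0 < limitSeq a (a.length * 2 ^ l - 1) →
      Doubles (a.length * 2 ^ l) (limitSeq a) := by
    intro l hl0
    have hp : 0 < a.length * 2 ^ l := by positivity
    have hlen : a.length * 2 ^ (l + 1) = a.length * 2 ^ l + a.length * 2 ^ l := by ring
    have h1 : ∀ j, j < a.length * 2 ^ l → limitSeq a (a.length * 2 ^ l + j) =
        (incrLast (reflect (blockWord a l))).getD j 0 := by
      intro j hj
      rw [← getD_blockWord (l := l + 1) (by omega), blockWord, List.getD_append_right _ _ _ _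
        (by rw [length_blockWord]; omega), length_blockWord, Nat.add_sub_cancel_left]
    have hlr : (reflect (blockWord a l)).length = a.length * 2 ^ l := by
      rw [length_reflect, length_blockWord]
    constructor
    · intro j hj
      rw [h1 j (by omega), getD_incrLast _ (by omega),
        getD_reflect _ (by rw [length_blockWord]; omega), getD_blockWord (by omega)]
    · have h2 := getD_incrLast_last (reflect (blockWord a l)) (by
        rw [← List.length_pos_iff, hlr]; exact hp)
      rw [hlr, getD_reflect _ (by rw [length_blockWord]; omega), getD_blockWord (by omega)] at h2
      rw [h1 _ (by omega), h2, Fin.val_add_one_of_lt (rev_lt_last hl0)]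
  refine key l ?_
  induction l with
  | zero =>
    have := limitSeq_incr ha hlast
    rw [pow_zero, mul_one, Fin.lt_def, this]
    simp
  | succ l ih =>
    have h2 := (key l ih).2
    have hp : 0 < a.length * 2 ^ l := by positivity
    rw [Fin.lt_def, show a.length * 2 ^ (l + 1) - 1 =
      a.length * 2 ^ l + (a.length * 2 ^ l - 1) by rw [pow_succ, ← mul_assoc]; omega, h2]
    simp

/-- Minimality of the period makes the comparison of `x` with its tails inside the block strict.
Raising the last digit of the block weakens a strict upper inequality to equality at worst, and it
makes the lower inequality strict when the latter was not yet decided inside the block. -/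
theorem adm_of_periodic {n : ℕ} {x c : ℕ → Fin (m + 1)} (hn : 0 < n)
    (hper : ∀ i, x (n + i) = x i) (hag : AgreeOn (n - 1) x c)
    (hincr : (c (n - 1) : ℕ) = (x (n - 1) : ℕ) + 1) (hmin : ∀ i, 0 < i → i < n → shift i x ≠ x)
    (hu : ∀ k, ¬ SeqLT x (shift k x)) (hl : ∀ k, SeqLT (reflectSeq x) (shift k x))
    (h0 : (x 0).rev < x 0) : Adm n c := by
  have hxc : ∀ j < n, x j ≤ c j := by
    intro j hj
    by_cases hj' : j < n - 1
    · exact (hag j hj').le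
    · obtain rfl : j = n - 1 := by omega
      rw [Fin.le_def]; omega
  have h0c : x 0 ≤ c 0 := hxc 0 hn
  refine ⟨hn, (Fin.rev_le_rev.2 h0c).trans_lt (h0.trans_le h0c), ?_, ?_⟩
  · intro i hi hin
    have hlt : SeqLT (shift i x) x := by
      rcases seqLT_trichotomy (shift i x) x with h | h | h
      · exact h
      · exact absurd h (hmin i hi hin)
      · exact absurd h (hu i)
    obtain ⟨k, hk1, hk2⟩ := hlt
    simp only [shift_apply] at hk1 hk2
    have hpre : ∀ j < k, i + j < n - 1 → c (i + j) = c j := fun j hj hij => by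
      rw [← hag _ hij, ← hag _ (by omega), hk1 j hj]
    rcases lt_trichotomy (i + k) (n - 1) with h | h | h
    · refine Or.inr ⟨k, by omega, fun j hj => hpre j hj (by omega), ?_⟩
      rwa [← hag _ h, ← hag _ (by omega)]
    · have hle : c (i + k) ≤ c k := by
        rw [h, ← hag k (by omega), Fin.le_def, hincr]
        rw [h] at hk2
        exact hk2
      rcases hle.lt_or_eq with hlt | heq
      · exact Or.inr ⟨k, by omega, fun j hj => hpre j hj (by omega), hlt⟩
      · left
        intro j hj
        rcases (show j ≤ k by omega).lt_or_eq with hjk | rfl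
        · exact hpre j hjk (by omega)
        · exact heq
    -- If the first difference came after the end of the block, then by periodicity the tail from `n
    -- - i` would exceed `x`.
    · refine absurd ⟨k - (n - i), fun j hj => ?_, ?_⟩ (hu (n - i))
      · rw [shift_apply, ← hk1 (n - i + j) (by omega), show i + (n - i + j) = n + j by omega, hper]
      · rw [shift_apply, show n - i + (k - (n - i)) = k by omega, ← hper,
          show n + (k - (n - i)) = i + k by omega]
        exact hk2
  · intro i hi hin
    obtain ⟨k, hk1, hk2⟩ := hl i
    simp only [shift_apply, reflectSeq_apply] at hk1 hk2
    have hpre : ∀ j < k, i + j < n - 1 → c (i + j) = (c j).rev := fun j hj hij => by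
      rw [← hag _ hij, ← hag _ (by omega), hk1 j hj]
    by_cases h : i + k < n
    · refine ⟨k, h, fun j hj => hpre j hj (by omega), ?_⟩
      rw [← hag k (by omega)]
      exact hk2.trans_le (hxc _ h)
    · refine ⟨n - 1 - i, by omega, fun j hj => hpre j (by omega) (by omega), ?_⟩
      have := hk1 (n - 1 - i) (by omega)
      rw [show i + (n - 1 - i) = n - 1 by omega] at this ⊢
      rw [← hag _ (by omega), this, Fin.lt_def, hincr]
      omega

/-! ### Bases -/

theorem Good.head_pos {q : ℝ} (hq : 1 < q) (hm : 1 ≤ m) {α : ℕ → Fin (m + 1)} (h : Good q α) :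
    0 < α 0 := by
  by_contra h0
  have h0' : α 0 = 0 := by
    rw [not_lt] at h0
    exact le_antisymm h0 (Fin.zero_le _)
  have h1 := h.tail 0 (by rw [h0', Fin.lt_def]; simpa using Nat.lt_of_lt_of_le one_pos hm)
  have h2 := val_succ hq α 0
  rw [shift_zero, h.val_eq, h0', eq_div_iff (by linarith)] at h2
  simp only [Fin.val_zero, Nat.cast_zero] at h2
  linarith

/-- The base is the sum of the first digit and the value of the following tail. Unless the first
digit is `m`, this tail is at most `1`, so a base above `⌊m / 2⌋ + 1` forces the first digit above
`m / 2`. -/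
theorem Good.rev_head_lt {q : ℝ} (hq : 1 < q) (hm : 1 ≤ m) (hM : ((m / 2 + 1 : ℕ) : ℝ) < q)
    {α : ℕ → Fin (m + 1)} (h : Good q α) : (α 0).rev < α 0 := by
  have h2 := val_succ hq α 0
  rw [shift_zero, h.val_eq, eq_div_iff (by linarith)] at h2
  rw [Fin.lt_def, Fin.val_rev]
  rcases (Fin.le_last (α 0)).lt_or_eq with h0 | h0
  · have h1 := h.tail 0 h0
    have h3 : ((m / 2 + 1 : ℕ) : ℝ) < ((α 0 : ℕ) + 1 : ℕ) := by push_cast at hM ⊢; linarith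
    have h4 : m / 2 + 1 < (α 0 : ℕ) + 1 := by exact_mod_cast h3
    omega
  · rw [h0, Fin.val_last]; omega

theorem reflect_lt_shift_of_mem {q : ℝ} (hm : 1 ≤ m) (hq : q ∈ univoqueBases m)
    {e : ℕ → Fin (m + 1)} (he : Good q e) {k : ℕ} (hk : 0 < k) :
    SeqLT (reflectSeq e) (shift k e) := by
  obtain ⟨⟨hq1, hqm⟩, h1⟩ := hq
  have hmem : e ∈ univoqueSeqs m q := ⟨1, h1, (isExpansion_iff hq1).2 he.val_eq⟩
  have hc := ((mem_univoqueSeqs_iff hq1 hqm he).1 hmem).2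
  have h0 := he.head_pos hq1 hm
  have := (hc.shift_lt (he.shift_one_le hq1) hk (rev_lt_last h0)).reflect
  rwa [shift_reflectSeq, reflectSeq_reflectSeq] at this

/-- If `q` is not itself univoque, the gap on its right forces univoque bases to approach it from
the left, and their expansions share arbitrarily long prefixes with `α`. This gives the weak
inequality; equality is excluded because those expansions are strictly smaller than `α`. -/
theorem reflect_lt_shift_of_mem_closure {q r : ℝ} (hm : 1 ≤ m) (hq : 1 < q)
    (hcl : q ∈ closure (univoqueBases m)) (hqr : q < r)
    (hgap : ∀ p ∈ univoqueBases m, p ∉ Set.Ioo q r) {α : ℕ → Fin (m + 1)} (hα : Good q α)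
    {k : ℕ} (hk : 0 < k) : SeqLT (reflectSeq α) (shift k α) := by
  by_cases hmem : q ∈ univoqueBases m
  · exact reflect_lt_shift_of_mem hm hmem hα hk
  have happrox : ∀ N, ∃ p ∈ univoqueBases m, p < q ∧ ∃ e, Good p e ∧ AgreeOn N e α := by
    intro N
    obtain ⟨p, hp, hpU⟩ := mem_closure_iff_nhds.1 hcl _
      ((hα.agree_left hq N).and (gt_mem_nhds hqr))
    have hpq : p < q := by
      rcases lt_trichotomy p q with h | h | h
      · exact h
      · exact absurd (h ▸ hpU) hmem
      · exact absurd ⟨h, hp.2⟩ (hgap p hpU)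
    obtain ⟨e, he⟩ := exists_good hpU.1.1 hpU.1.2
    exact ⟨p, hpU, hpq, e, he, hp.1 e hpq he⟩
  rcases seqLT_trichotomy (reflectSeq α) (shift k α) with h | h | h
  · exact h
  · exfalso
    -- Suppose `shift k α` is the reflection of `α`. An approximation `e` that drops below `α` first
    -- at position `t ≥ k` then has its tail from `k` drop below the reflection of `e` at position
    -- `t - k`.
    obtain ⟨p, hpU, hpq, e, he, hag⟩ := happrox k
    obtain ⟨t, ht1, ht2⟩ := he.lt_of_lt hpU.1.1 hpq hα
    have htk : k ≤ t := by
      by_contra htk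
      exact ht2.ne (hag t (by omega))
    have h' : ∀ j, α (k + j) = (α j).rev := fun j => (congrFun h j).symm
    refine (reflect_lt_shift_of_mem hm hpU he hk).asymm ⟨t - k, fun j hj => ?_, ?_⟩
    · rw [shift_apply, ht1 _ (by omega), h', reflectSeq_apply, ht1 _ (by omega)]
    · have := h' (t - k)
      rw [show k + (t - k) = t by omega] at this
      rw [shift_apply, reflectSeq_apply, ht1 (t - k) (by omega), ← this,
        show k + (t - k) = t by omega]
      exact ht2
  · exfalso
    obtain ⟨j, hj1, hj2⟩ := h
    obtain ⟨p, hpU, hpq, e, he, hag⟩ := happrox (k + j + 1)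
    refine (reflect_lt_shift_of_mem hm hpU he hk).asymm ⟨j, fun i hi => ?_, ?_⟩
    · have := hj1 i hi
      rw [shift_apply, reflectSeq_apply] at this ⊢
      rw [hag _ (by omega), hag _ (by omega), this]
    · rw [shift_apply, reflectSeq_apply] at hj2 ⊢
      rw [hag _ (by omega), hag _ (by omega)]
      exact hj2

theorem Tower.infNonzero {n : ℕ} {x c : ℕ → Fin (m + 1)} (T : Tower n x c) : InfNonzero c := by
  intro k
  obtain ⟨j, -, hj⟩ := T.reflect_lt_shift k
  exact ⟨k + j, by omega, (Fin.zero_le _).trans_lt hj |>.ne'⟩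

/-- If `x` is the quasi-greedy expansion of `1` in the left endpoint of a gap in the set of
univoque bases, then `c` is the one in the right endpoint. -/
theorem Tower.good_right {n : ℕ} {x c : ℕ → Fin (m + 1)} (T : Tower n x c) (hm : 1 ≤ m) {q r : ℝ}
    (hq : 1 < q) (hqr : q < r) (hrm : r ≤ m + 1) (hx : Good q x)
    (hx0 : (x 0).rev < x 0)
    (hr : r ∈ closure (univoqueBases m))
    (hgap : ∀ p ∈ univoqueBases m, p ∉ Set.Ioo q r) : Good r c := by
  have hc1 : 1 < val q c := hx.one_lt_val hq T.periodic_lt T.infNonzero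
  have hm1 : (1 : ℝ) < m + 1 := hq.trans (hqr.trans_le hrm)
  have hc2 : val (m + 1) c ≤ 1 := by
    refine (val_le hm1 c).trans ?_
    rw [add_sub_cancel_right]
    exact div_self_le_one _
  -- The value of `c` exceeds `1` in base `q` and is at most `1` in base `m + 1`; hence it equals
  -- `1` in some base `p`, which turns out to be univoque.
  obtain ⟨p, ⟨hp1, hp2⟩, hp⟩ := intermediate_value_Icc' (hqr.le.trans hrm)
    ((continuousOn_val hq c).mono fun _ h => h.1) (show (1 : ℝ) ∈ _ from ⟨hc2, hc1.le⟩)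
  simp only at hp
  have hqp : q < p := lt_of_le_of_ne hp1 fun h => by
    rw [← h] at hp; linarith
  have hp0 : 1 < p := hq.trans hqp
  have hgood : Good p c := good_of_shift_le hp0 hp T.infNonzero fun k => by
    rcases Nat.eq_zero_or_pos k with rfl | hk
    · simpa using SeqLT.irrefl c
    · exact (T.shift_lt hk).asymm
  have hmem : p ∈ univoqueBases m := by
    obtain ⟨y, hy, hc⟩ := mem_of_upperCond hp0 hgood (fun k _ => T.shift_lt (Nat.succ_pos k))
      (fun k _ => by
        have := (T.reflect_lt_shift (k + 1)).reflect
        rwa [reflectSeq_reflectSeq] at this)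
    rw [isExpansion_iff hp0, hp] at hc
    exact ⟨⟨hp0, hp2⟩, hc ▸ hy⟩
  have hrp : r ≤ p := by
    by_contra h
    exact hgap p hmem ⟨hqp, not_le.1 h⟩
  rcases hrp.eq_or_lt with rfl | hrp
  · exact hgood
  · exfalso
    -- Univoque bases accumulate at or include `r`, so one of them lies in `(q, p)`; its expansion
    -- of `1` lies between `x` and `c`.
    obtain ⟨s, ⟨hs1, hs2⟩, hsU⟩ := mem_closure_iff_nhds.1 hr _ (Ioo_mem_nhds hqr hrp)
    have hs0 : 1 < s := hsU.1.1
    obtain ⟨e, he⟩ := exists_good hs0 hsU.1.2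
    have hxe := hx.lt_of_lt hq hs1 he
    refine T.gap hxe (he.lt_of_lt hs0 hs2 hgood) (fun k => he.shift_le hs0 k) fun k => ?_
    rcases Nat.eq_zero_or_pos k with rfl | hk
    · rw [shift_zero]
      have hxx : SeqLT (reflectSeq x) x := ⟨0, by simp, hx0⟩
      exact (hxe.reflect.trans hxx).trans hxe
    · exact reflect_lt_shift_of_mem hm hsU he hk

/-- An endpoint outside the closure of the univoque bases would belong to the complement set and
could be added to the component. -/
theorem IsComponentInterval.spec {q r : ℝ} (h : IsComponentInterval (complementSet m) q r)
    (hM : ((m / 2 + 1 : ℕ) : ℝ) < q) :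
    q < r ∧ r ≤ m + 1 ∧ q ∈ closure (univoqueBases m) ∧ r ∈ closure (univoqueBases m) ∧
      ∀ p ∈ univoqueBases m, p ∉ Set.Ioo q r := by
  obtain ⟨x, hx, hC⟩ := h
  have hxI : x ∈ Set.Ioo q r := hC ▸ mem_connectedComponentIn hx
  have hsub : Set.Ioo q r ⊆ complementSet m := hC ▸ connectedComponentIn_subset _ _
  have hqr : q < r := hxI.1.trans hxI.2
  have hrm : r ≤ m + 1 := by
    by_contra! hcon
    obtain ⟨y, hy1, hy2⟩ := exists_between (max_lt hcon hqr)
    have := (hsub ⟨(le_max_right _ _).trans_lt hy1, hy2⟩).1.2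
    exact absurd ((le_max_left _ _).trans_lt hy1) (not_lt.2 this)
  refine ⟨hqr, hrm, ?_, ?_, fun p hp hpI => (hsub hpI).2 (subset_closure hp)⟩
  · by_contra hcl
    have hq : q ∈ complementSet m := ⟨⟨hM, hqr.le.trans hrm⟩, hcl⟩
    have h1 : Set.Ico q r ⊆ complementSet m := fun y hy => by
      rcases hy.1.eq_or_lt with rfl | hlt
      · exact hq
      · exact hsub ⟨hlt, hy.2⟩
    have h2 := isPreconnected_Ico.subset_connectedComponentIn ⟨hxI.1.le, hxI.2⟩ h1
      (show q ∈ Set.Ico q r from ⟨le_rfl, hqr⟩)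
    rw [hC] at h2
    exact lt_irrefl _ h2.1
  · by_contra hcl
    have hr : r ∈ complementSet m := ⟨⟨hM.trans hqr, hrm⟩, hcl⟩
    have h1 : Set.Ioc q r ⊆ complementSet m := fun y hy => by
      rcases hy.2.eq_or_lt with rfl | hlt
      · exact hr
      · exact hsub ⟨hy.1, hlt⟩
    have h2 := isPreconnected_Ioc.subset_connectedComponentIn ⟨hxI.1, hxI.2.le⟩ h1
      (show r ∈ Set.Ioc q r from ⟨hqr, le_rfl⟩)
    rw [hC] at h2
    exact lt_irrefl _ h2.2

/-- The quasi-greedy expansions of `1` in the endpoints of a gap. -/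
theorem tower_of_component (hm : 1 ≤ m) {q r : ℝ}
    (hcomp : IsComponentInterval (complementSet m) q r) (hM : ((m / 2 + 1 : ℕ) : ℝ) < q)
    {α : ℕ → Fin (m + 1)} (hα : IsQuasiGreedy q 1 α) {a : List (Fin (m + 1))}
    (ha : IsSmallestBlock a α) :
    1 < q ∧ q < r ∧ r ≤ m + 1 ∧ Tower a.length (periodicSeq a) (limitSeq a) ∧
      Good q (periodicSeq a) ∧ Good r (limitSeq a) ∧
      ∀ k, SeqLT (reflectSeq (periodicSeq a)) (shift k (periodicSeq a)) := by
  obtain ⟨hqr, hrm, hq, hr, hgap⟩ := hcomp.spec hM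
  obtain ⟨hne, rfl, hmin⟩ := ha
  have hpos := List.length_pos_iff.2 hne
  have hq1 : 1 < q := by
    refine lt_of_le_of_lt ?_ hM
    exact_mod_cast Nat.le_add_left 1 (m / 2)
  have hG := hα.good hq1 (hqr.le.trans hrm)
  have h0 := hG.rev_head_lt hq1 hm hM
  have hu := hG.shift_le hq1
  have hl : ∀ k, SeqLT (reflectSeq (periodicSeq a)) (shift k (periodicSeq a)) := fun k => by
    rcases Nat.eq_zero_or_pos k with rfl | hk
    · exact ⟨0, by simp, by simpa using h0⟩
    · exact reflect_lt_shift_of_mem_closure hm hq1 hq hqr hgap hG hk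
  -- If the last digit of `a` were `m`, the tail from it would be `m x`. Since no tail exceeds `x`,
  -- this forces `m x = x`, hence `q = m + 1`, which contradicts `q < r ≤ m + 1`.
  have hlast : periodicSeq a (a.length - 1) < Fin.last m := by
    refine lt_of_le_of_ne (Fin.le_last _) fun heq => ?_
    have hshift : shift (a.length - 1 + 1) (periodicSeq a) = periodicSeq a := by
      funext i
      rw [shift_apply, Nat.sub_add_cancel hpos, periodicSeq_add]
    have h1 := val_succ hq1 (periodicSeq a) (a.length - 1)
    have h2 : shift (a.length - 1) (periodicSeq a) = periodicSeq a := by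
      rcases seqLT_trichotomy (shift (a.length - 1) (periodicSeq a)) (periodicSeq a)
        with h | h | h
      · obtain ⟨k, hk1, hk2⟩ := h
        cases k with
        | zero =>
          rw [shift_apply, Nat.add_zero (a.length - 1), heq] at hk2
          exact absurd (Fin.le_last _) (not_le.2 hk2)
        | succ k =>
          have hs : ∀ j, shift (a.length - 1) (periodicSeq a) (j + 1) = periodicSeq a j :=
            fun j => by
              rw [← periodicSeq_add a j, shift_apply]
              congr 1
              omega
          refine absurd ⟨k, fun j hj => ?_, ?_⟩ (hu 1)
          · rw [shift_apply, Nat.add_comm 1 j, ← hk1 (j + 1) (by omega), hs]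
          · rw [shift_apply, Nat.add_comm 1 k, ← hs]
            exact hk2
      · exact h
      · exact absurd h (hu _)
    rw [hshift, h2, hG.val_eq, heq, Fin.val_last, eq_div_iff (by linarith)] at h1
    linarith
  have hadm : Adm a.length (limitSeq a) := by
    refine adm_of_periodic hpos (periodicSeq_add a) (limitSeq_agree a) (limitSeq_incr hne hlast)
      (fun i hi hin heq => ?_) hu hl h0
    refine absurd (hmin i hi fun j => ?_) (not_le.2 hin)
    rw [Nat.add_comm j i]
    exact congrFun heq j
  have T : Tower a.length (periodicSeq a) (limitSeq a) :=
    ⟨periodicSeq_add a, limitSeq_agree a, limitSeq_incr hne hlast, hadm,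
      limitSeq_doubles hne hlast⟩
  exact ⟨hq1, hqr, hrm, T, hG, T.good_right hm hq1 hqr hrm hG h0 hr hgap, hl⟩

/-! ### Concatenations -/

@[simp] theorem appendSeq_nil (s : ℕ → Fin (m + 1)) : appendSeq [] s = s := by
  funext i; simp [appendSeq]

theorem appendSeq_of_lt (w : List (Fin (m + 1))) (s : ℕ → Fin (m + 1)) {i : ℕ}
    (hi : i < w.length) : appendSeq w s i = w.getD i 0 := by
  simp [appendSeq, hi]

theorem shift_appendSeq (w : List (Fin (m + 1))) (s : ℕ → Fin (m + 1)) (k : ℕ) :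
    shift (w.length + k) (appendSeq w s) = shift k s := by
  funext i
  simp only [shift_apply, appendSeq]
  rw [if_neg (by omega)]
  congr 1; omega

theorem shift_length_appendSeq (w : List (Fin (m + 1))) (s : ℕ → Fin (m + 1)) :
    shift w.length (appendSeq w s) = s := by
  simpa using shift_appendSeq w s 0

theorem appendSeq_append (u v : List (Fin (m + 1))) (s : ℕ → Fin (m + 1)) :
    appendSeq (u ++ v) s = appendSeq u (appendSeq v s) := by
  funext i
  simp only [appendSeq, List.length_append]
  by_cases h1 : i < u.length
  · rw [if_pos (by omega), if_pos h1, List.getD_append _ _ _ _ h1]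
  · by_cases h2 : i - u.length < v.length
    · rw [if_pos (by omega), if_neg h1, if_pos h2, List.getD_append_right _ _ _ _ (by omega)]
    · rw [if_neg (by omega), if_neg h1, if_neg h2]
      congr 1; omega

theorem eq_appendSeq {w : List (Fin (m + 1))} {y : ℕ → Fin (m + 1)}
    (h : ∀ j < w.length, y j = w.getD j 0) : y = appendSeq w (shift w.length y) := by
  funext i
  by_cases hi : i < w.length
  · rw [appendSeq_of_lt w _ hi, h i hi]
  · simp only [appendSeq, if_neg hi, shift_apply]
    congr 1; omega

theorem appendSeq_inj {w : List (Fin (m + 1))} {s t : ℕ → Fin (m + 1)}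
    (h : appendSeq w s = appendSeq w t) : s = t := by
  rw [← shift_length_appendSeq w s, h, shift_length_appendSeq]

theorem appendSeq_periodicSeq (w : List (Fin (m + 1))) :
    appendSeq w (periodicSeq w) = periodicSeq w := by
  have h : periodicSeq w = appendSeq w (shift w.length (periodicSeq w)) :=
    eq_appendSeq fun j hj => periodicSeq_of_lt w hj
  rw [show shift w.length (periodicSeq w) = periodicSeq w from
    funext fun i => periodicSeq_add w i] at h
  exact h.symm

theorem eq_replicate_append {w : List (Fin (m + 1))} {y : ℕ → Fin (m + 1)} {J : ℕ}
    (h : ∀ j < J, ∀ i < w.length, y (w.length * j + i) = w.getD i 0) :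
    y = appendSeq (List.replicate J w).flatten (shift (w.length * J) y) := by
  induction J with
  | zero => simp
  | succ J ih =>
    rw [List.replicate_succ', List.flatten_append, List.flatten_singleton, appendSeq_append,
      show w.length * (J + 1) = w.length * J + w.length by ring, ← shift_shift,
      ← eq_appendSeq (y := shift (w.length * J) y) (h J (by omega)), ← ih fun j hj => h j (by omega)]

theorem eq_periodicSeq {w : List (Fin (m + 1))} (hw : w ≠ []) {y : ℕ → Fin (m + 1)}
    (h : ∀ j, ∀ i < w.length, y (w.length * j + i) = w.getD i 0) : y = periodicSeq w := by
  funext i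
  have := h (i / w.length) (i % w.length) (Nat.mod_lt _ (List.length_pos_iff.2 hw))
  rwa [Nat.div_add_mod] at this

/-! ### Infinite products of words -/

theorem finProd_succ (F : ℕ → List (Fin (m + 1)) × ℕ∞) (N : ℕ) :
    finProd F (N + 1) = finProd F N ++ (List.replicate (F N).2.toNat (F N).1).flatten := by
  simp [finProd, List.range_succ]

theorem finProd_succ' (F : ℕ → List (Fin (m + 1)) × ℕ∞) (N : ℕ) :
    finProd F (N + 1) = (List.replicate (F 0).2.toNat (F 0).1).flatten ++
      finProd (fun s => F (s + 1)) N := by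
  simp [finProd, List.range_succ_eq_map, Function.comp_def]

theorem finProd_prefix (F : ℕ → List (Fin (m + 1)) × ℕ∞) {N K : ℕ} (h : N ≤ K) :
    ∃ v, finProd F K = finProd F N ++ v := by
  induction K, h using Nat.le_induction with
  | base => exact ⟨[], by simp⟩
  | succ K _ ih =>
    obtain ⟨v, hv⟩ := ih
    exact ⟨_, by rw [finProd_succ, hv, List.append_assoc]⟩

/-- A first factor with exponent `0` can be dropped. -/
theorem IsInfProd.tail {F : ℕ → List (Fin (m + 1)) × ℕ∞} {s : ℕ → Fin (m + 1)}
    (h : IsInfProd F s) (h0 : (F 0).2 = 0) : IsInfProd (fun s => F (s + 1)) s := by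
  have hfin : ∀ N, finProd F (N + 1) = finProd (fun s => F (s + 1)) N := fun N => by
    rw [finProd_succ', h0]; simp
  rcases h with ⟨r, h1, h2, h3⟩ | ⟨h1, h2, h3⟩
  · cases r with
    | zero => rw [h0] at h2; exact absurd h2 (by simp)
    | succ r =>
      exact Or.inl ⟨r, fun s hs => h1 (s + 1) (by omega), h2, by rw [h3, hfin]⟩
  · refine Or.inr ⟨fun s => h1 (s + 1), fun N => ?_, fun L => ?_⟩
    · rw [← hfin]; exact h2 _
    · obtain ⟨N, hN⟩ := h3 L
      refine ⟨N, hN.trans ?_⟩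
      obtain ⟨v, hv⟩ := finProd_prefix F (Nat.le_succ N)
      rw [← hfin, hv, List.length_append]
      omega

/-- Replacement of the exponent of the first factor. -/
def setExp (F : ℕ → List (Fin (m + 1)) × ℕ∞) (k : ℕ∞) : ℕ → List (Fin (m + 1)) × ℕ∞
  | 0 => ((F 0).1, k)
  | s + 1 => F (s + 1)

/-- One copy of the first word can be split off if its exponent is positive. -/
theorem IsInfProd.split {F : ℕ → List (Fin (m + 1)) × ℕ∞} {s : ℕ → Fin (m + 1)}
    (h : IsInfProd F s) {k : ℕ∞} (h0 : (F 0).2 = k + 1) :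
    ∃ t, s = appendSeq (F 0).1 t ∧ IsInfProd (setExp F k) t := by
  have hfin : k ≠ ⊤ → ∀ N, finProd F (N + 1) = (F 0).1 ++ finProd (setExp F k) (N + 1) := by
    intro hk N
    rw [finProd_succ', finProd_succ', h0, ENat.toNat_add hk (by simp)]
    simp [List.replicate_succ, setExp]
  have hk : (F 0).2 ≠ ⊤ → k ≠ ⊤ := by
    rintro h rfl
    exact h (by rw [h0]; simp)
  rcases h with ⟨r, h1, h2, h3⟩ | ⟨h1, h2, h3⟩
  · cases r with
    | zero =>
      have hk : k = ⊤ := by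
        rw [h2] at h0
        by_contra hk
        lift k to ℕ using hk
        exact absurd h0 (ENat.top_ne_natCast (k + 1))
      have hs : s = periodicSeq (F 0).1 := by rw [h3]; simp [finProd]
      refine ⟨periodicSeq (F 0).1, by rw [appendSeq_periodicSeq, hs], Or.inl ⟨0, by simp, hk, ?_⟩⟩
      simp [finProd, setExp]
    | succ r =>
      have hk' := hk (h1 0 (by omega))
      rw [hfin hk', appendSeq_append] at h3
      refine ⟨_, h3, Or.inl ⟨r + 1, fun s hs => ?_, h2, rfl⟩⟩
      cases s with
      | zero => exact hk'
      | succ s => exact h1 (s + 1) hs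
  · have hk' := hk (h1 0)
    obtain ⟨t, ht⟩ := h2 1
    rw [hfin hk', appendSeq_append] at ht
    refine ⟨_, ht, Or.inr ⟨fun s => ?_, fun N => ?_, fun L => ?_⟩⟩
    · cases s with
      | zero => exact hk'
      | succ s => exact h1 (s + 1)
    · obtain ⟨t', ht'⟩ := h2 (N + 1)
      rw [hfin hk', appendSeq_append] at ht'
      obtain ⟨v, hv⟩ := finProd_prefix (setExp F k) (Nat.le_succ N)
      rw [ht] at ht'
      rw [appendSeq_inj ht', Nat.succ_eq_add_one] at *
      exact ⟨appendSeq v t', by rw [hv, appendSeq_append]⟩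
    · obtain ⟨N, hN⟩ := h3 (L + (F 0).1.length)
      refine ⟨N + 1, ?_⟩
      obtain ⟨v, hv⟩ := finProd_prefix F (Nat.le_succ N)
      have e1 := congrArg List.length hv
      rw [Nat.succ_eq_add_one, hfin hk', List.length_append, List.length_append] at e1
      omega

theorem IsInfProd.exists_exp_ne_zero {F : ℕ → List (Fin (m + 1)) × ℕ∞} {s : ℕ → Fin (m + 1)}
    (h : IsInfProd F s) : ∃ N, (F N).2 ≠ 0 := by
  rcases h with ⟨r, -, h2, -⟩ | ⟨-, -, h3⟩
  · exact ⟨r, by rw [h2]; simp⟩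
  · by_contra! hcon
    obtain ⟨N, hN⟩ := h3 1
    have : ∀ N, finProd F N = [] := fun N => by
      induction N with
      | zero => rfl
      | succ N ih => rw [finProd_succ, ih, hcon]; simp
    rw [this] at hN
    simp at hN

/-! ### Sequences all whose tails lie between the reflection of `c` and `c` -/

/-- All tails of `y` lie strictly between the reflection of `c` and `c`. -/
def TailsBetween (c y : ℕ → Fin (m + 1)) : Prop :=
  ∀ k, SeqLT (reflectSeq c) (shift k y) ∧ SeqLT (shift k y) c

theorem TailsBetween.shift {c y : ℕ → Fin (m + 1)} (h : TailsBetween c y) (k : ℕ) :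
    TailsBetween c (shift k y) := fun l => by rw [shift_shift]; exact h _

/-- The word `c_p c̄_q`. -/
def pairWord (a : List (Fin (m + 1))) (p q : ℕ) : List (Fin (m + 1)) :=
  blockWord a p ++ reflect (blockWord a q)

theorem length_pairWord (a : List (Fin (m + 1))) (p q : ℕ) :
    (pairWord a p q).length = a.length * 2 ^ p + a.length * 2 ^ q := by
  rw [pairWord, List.length_append, length_reflect, length_blockWord, length_blockWord]

theorem getD_pairWord_iff {a : List (Fin (m + 1))} {p q : ℕ} {y : ℕ → Fin (m + 1)} :
    (∀ j < (pairWord a p q).length, y j = (pairWord a p q).getD j 0) ↔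
      AgreeOn (a.length * 2 ^ p) y (limitSeq a) ∧
        AgreeOn (a.length * 2 ^ q) (shift (a.length * 2 ^ p) y) (reflectSeq (limitSeq a)) := by
  have h1 : ∀ j < a.length * 2 ^ p, (pairWord a p q).getD j 0 = limitSeq a j := fun j hj => by
    rw [pairWord, List.getD_append _ _ _ _ (by rwa [length_blockWord]), getD_blockWord hj]
  have h2 : ∀ j < a.length * 2 ^ q, (pairWord a p q).getD (a.length * 2 ^ p + j) 0 =
      (limitSeq a j).rev := fun j hj => by
    rw [pairWord, List.getD_append_right _ _ _ _ (by rw [length_blockWord]; omega),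
      length_blockWord, Nat.add_sub_cancel_left, getD_reflect _ (by rwa [length_blockWord]),
      getD_blockWord hj]
  rw [length_pairWord]
  constructor
  · intro h
    exact ⟨fun j hj => by rw [h j (by omega), h1 j hj],
      fun j hj => by rw [shift_apply, h _ (by omega), h2 j hj, reflectSeq_apply]⟩
  · rintro ⟨h3, h4⟩ j hj
    by_cases hjp : j < a.length * 2 ^ p
    · rw [h3 j hjp, h1 j hjp]
    · have := h4 (j - a.length * 2 ^ p) (by omega)
      rw [shift_apply, reflectSeq_apply, ← h2 _ (by omega),
        show a.length * 2 ^ p + (j - a.length * 2 ^ p) = j by omega] at this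
      exact this

section

variable {a : List (Fin (m + 1))} {x : ℕ → Fin (m + 1)} (T : Tower a.length x (limitSeq a))
include T

theorem pairWord_ne_nil (p q : ℕ) : pairWord a p q ≠ [] := by
  rw [← List.length_pos_iff, length_pairWord]
  have := T.len_pos p
  omega

/-- Coinduction principle for products of words `c_p c̄_q` with nondecreasing indices. -/
theorem tailsBetween_of_pairs {R : ℕ → (ℕ → Fin (m + 1)) → Prop}
    (hR : ∀ i s, R i s → ∃ p q t, i ≤ p ∧ p ≤ q ∧ s = appendSeq (pairWord a p q) t ∧ R q t)
    {i : ℕ} {s : ℕ → Fin (m + 1)} (h : R i s) :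
    TailsBetween (limitSeq a) s ∧ AgreeOn (a.length * 2 ^ i) s (limitSeq a) := by
  set c := limitSeq a with hc
  have hsplit : ∀ {p q s t}, s = appendSeq (pairWord a p q) t →
      AgreeOn (a.length * 2 ^ p) s c ∧
        AgreeOn (a.length * 2 ^ q) (shift (a.length * 2 ^ p) s) (reflectSeq c) := by
    rintro p q s t rfl
    exact getD_pairWord_iff.1 fun j hj => appendSeq_of_lt _ _ hj
  have hhead : ∀ {i s}, R i s → AgreeOn (a.length * 2 ^ i) s c := by
    intro i s h
    obtain ⟨p, q, t, hip, -, hs, -⟩ := hR i s h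
    exact (hsplit hs).1.mono (len_mono _ hip)
  -- tails which start in a block followed by the reflection of a longer block
  have hblock : ∀ {p q : ℕ} {y : ℕ → Fin (m + 1)} {k : ℕ}, p ≤ q →
      AgreeOn (a.length * 2 ^ p) y c →
      AgreeOn (a.length * 2 ^ q) (shift (a.length * 2 ^ p) y) (reflectSeq c) →
      k < a.length * 2 ^ p →
      SeqLT (reflectSeq c) (shift k y) ∧ SeqLT (shift k y) c := by
    intro p q y k hpq h1 h2 hk
    have h2' := h2.mono (len_mono a.length hpq)
    refine ⟨(T.adm_pow p).reflect_lt_shift h1 hk, ?_⟩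
    rcases Nat.eq_zero_or_pos k with rfl | hk0
    · have hpos := T.len_pos p
      rw [shift_zero]
      -- Here `y` starts with `c_p c̄_p`, which differs from the prefix `c_p c̄_p⁺` of `c` only in
      -- its last digit.
      refine ⟨a.length * 2 ^ p + (a.length * 2 ^ p - 1), fun j hj => ?_, ?_⟩
      · by_cases hjp : j < a.length * 2 ^ p
        · exact h1 j hjp
        · obtain ⟨j, rfl⟩ : ∃ j', j = a.length * 2 ^ p + j' := ⟨j - a.length * 2 ^ p, by omega⟩
          rw [← shift_apply _ j y, h2' j (by omega), (T.doubles p).1 j (by omega), reflectSeq_apply]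
      · rw [← shift_apply _ _ y, h2' _ (by omega), reflectSeq_apply, Fin.lt_def, (T.doubles p).2]
        omega
    · exact (T.adm_pow p).shift_lt h1 (h2'.mono (Nat.sub_le _ _)) hk0 hk
  refine ⟨fun k => ?_, hhead h⟩
  induction k using Nat.strong_induction_on generalizing i s with
  | _ k ih =>
    obtain ⟨p, q, t, hip, hpq, hs, hRt⟩ := hR i s h
    obtain ⟨h1, h2⟩ := hsplit hs
    by_cases hk1 : k < a.length * 2 ^ p
    · exact hblock hpq h1 h2 hk1
    · obtain ⟨k, rfl⟩ : ∃ k', k = a.length * 2 ^ p + k' := ⟨k - a.length * 2 ^ p, by omega⟩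
      by_cases hk2 : k < a.length * 2 ^ q
      -- The tail starts inside `c̄_q`. After reflection this is a block `c_q` followed by the
      -- reflection of `t`, and `t` starts with `c_q`, so the previous case applies.
      · have ht : t = shift (a.length * 2 ^ q) (shift (a.length * 2 ^ p) s) := by
          rw [shift_shift, hs, ← length_pairWord, shift_length_appendSeq]
        have h3 := hhead hRt
        have := hblock (y := reflectSeq (shift (a.length * 2 ^ p) s)) le_rfl
          (by simpa [reflectSeq_reflectSeq] using h2.reflect)
          (by rw [shift_reflectSeq, ← ht]; exact h3.reflect) hk2
        rw [shift_reflectSeq, shift_shift] at this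
        refine ⟨?_, ?_⟩
        · exact seqLT_reflect_iff.1 (by simpa [reflectSeq_reflectSeq] using this.2)
        · exact seqLT_reflect_iff.1 this.1
      · have hpos := T.len_pos p
        have := ih (k - a.length * 2 ^ q) (by omega) hRt
        rw [← shift_appendSeq (pairWord a p q) t, ← hs, length_pairWord,
          show a.length * 2 ^ p + a.length * 2 ^ q + (k - a.length * 2 ^ q) =
            a.length * 2 ^ p + k by omega] at this
        exact this

/-- The factors of `F` are the words `c_p c̄_q`, with nondecreasing indices. -/
def IsPairProduct (a : List (Fin (m + 1))) (F : ℕ → List (Fin (m + 1)) × ℕ∞) (p q : ℕ → ℕ) :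
    Prop :=
  ∀ t, (F t).1 = pairWord a (p t) (q t) ∧ p t ≤ q t ∧ q t ≤ p (t + 1) ∧
    (p t = q t ∨ (F t).2 ≤ 1)

omit T in
-- If copies of the first word remain after one is removed, then the exponent exceeds `1`, so both
-- its indices coincide and the indices stay nondecreasing.
theorem IsPairProduct.split {F : ℕ → List (Fin (m + 1)) × ℕ∞} {p q : ℕ → ℕ}
    (hF : IsPairProduct a F p q) {s : ℕ → Fin (m + 1)} (hs : IsInfProd F s) (h0 : (F 0).2 ≠ 0) :
    ∃ t F' p' q', s = appendSeq (pairWord a (p 0) (q 0)) t ∧ IsPairProduct a F' p' q' ∧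
      q 0 ≤ p' 0 ∧ IsInfProd F' t := by
  obtain ⟨k, hk⟩ : ∃ k, (F 0).2 = k + 1 :=
    ⟨(F 0).2 - 1, (tsub_add_cancel_of_le (Order.one_le_iff_ne_zero.2 h0)).symm⟩
  obtain ⟨t, ht1, ht2⟩ := hs.split hk
  rw [(hF 0).1] at ht1
  by_cases hk0 : k = 0
  · exact ⟨t, _, fun t => p (t + 1), fun t => q (t + 1), ht1, fun t => hF (t + 1), (hF 0).2.2.1,
      ht2.tail hk0⟩
  · have hpq : p 0 = q 0 := by
      refine (hF 0).2.2.2.resolve_right fun h => hk0 ?_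
      rw [hk] at h
      have h' : k + 1 ≤ 0 + 1 := by simpa using h
      simpa using (ENat.add_le_add_iff_right (by simp)).1 h'
    refine ⟨t, _, p, q, ht1, fun t => ?_, hpq.ge, ht2⟩
    cases t with
    | zero => exact ⟨(hF 0).1, (hF 0).2.1, (hF 0).2.2.1, Or.inl hpq⟩
    | succ t => exact hF (t + 1)

theorem tailsBetween_of_isInfProd {F : ℕ → List (Fin (m + 1)) × ℕ∞} {p q : ℕ → ℕ}
    (hF : IsPairProduct a F p q) {s : ℕ → Fin (m + 1)} (hs : IsInfProd F s) :
    TailsBetween (limitSeq a) s ∧ AgreeOn a.length s (limitSeq a) := by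
  -- The coinductive invariant only records a lower bound for the indices still to come. Leading
  -- factors with exponent `0` are skipped by induction on the position of a nonzero exponent.
  let R : ℕ → (ℕ → Fin (m + 1)) → Prop := fun i s => ∃ F, ∃ p q : ℕ → ℕ,
    IsPairProduct a F p q ∧ i ≤ p 0 ∧ IsInfProd F s
  have hR : ∀ i s, R i s →
      ∃ p q t, i ≤ p ∧ p ≤ q ∧ s = appendSeq (pairWord a p q) t ∧ R q t := by
    rintro i s ⟨F, p, q, hF, hi, hs⟩
    obtain ⟨N, hN⟩ := hs.exists_exp_ne_zero
    induction N generalizing F p q with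
    | zero =>
      obtain ⟨t, F', p', q', h1, h2, h3, h4⟩ := hF.split hs hN
      exact ⟨p 0, q 0, t, hi, (hF 0).2.1, h1, F', p', q', h2, h3, h4⟩
    | succ N ih =>
      by_cases h0 : (F 0).2 = 0
      · exact ih _ (fun t => p (t + 1)) (fun t => q (t + 1)) (fun t => hF (t + 1))
          (hi.trans ((hF 0).2.1.trans (hF 0).2.2.1)) (hs.tail h0) hN
      · obtain ⟨t, F', p', q', h1, h2, h3, h4⟩ := hF.split hs h0
        exact ⟨p 0, q 0, t, hi, (hF 0).2.1, h1, F', p', q', h2, h3, h4⟩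
  have := tailsBetween_of_pairs T hR (i := 0) (s := s) ⟨F, p, q, hF, Nat.zero_le _, hs⟩
  simpa using this

/-- Splitting off the powers of `c_i c̄_i` at the beginning of a sequence. -/
theorem exists_split {y : ℕ → Fin (m + 1)} {i : ℕ} (hy : TailsBetween (limitSeq a) y)
    (hi : AgreeOn (a.length * 2 ^ i) y (limitSeq a)) :
    y = periodicSeq (pairWord a i i) ∨ ∃ J l i' y', l ≤ 1 ∧ i < i' ∧
      y = appendSeq (List.replicate J (pairWord a i i)).flatten
        (appendSeq (List.replicate l (pairWord a i i')).flatten y') ∧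
      TailsBetween (limitSeq a) y' ∧ AgreeOn (a.length * 2 ^ i') y' (limitSeq a) := by
  classical
  set c := limitSeq a with hc
  set L := a.length * 2 ^ i with hL
  have hLpos : 0 < L := T.len_pos i
  have hlen : (pairWord a i i).length = L + L := length_pairWord a i i
  by_cases hall : ∀ j, AgreeOn L (shift ((L + L) * j) y) c ∧
      AgreeOn L (shift L (shift ((L + L) * j) y)) (reflectSeq c)
  · left
    refine eq_periodicSeq (pairWord_ne_nil T i i) fun j => ?_
    have := getD_pairWord_iff.2 (hall j)
    rwa [hlen] at this ⊢
  right
  -- The block `c_i` at place `j` is continued by `c̄_i c_i`; the exponent `J` is the first place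
  -- where this fails.
  let Q : ℕ → Prop := fun j => AgreeOn L (shift L (shift ((L + L) * j) y)) (reflectSeq c) ∧
    AgreeOn L (shift ((L + L) * (j + 1)) y) c
  have hstart : ∀ J, (∀ j < J, Q j) → AgreeOn L (shift ((L + L) * J) y) c := by
    intro J hJ
    cases J with
    | zero => simpa using hi
    | succ J => exact (hJ J (by omega)).2
  have hex : ∃ J, ¬ Q J := by
    by_contra! hcon
    exact hall fun j => ⟨hstart j fun k _ => hcon k, (hcon j).1⟩
  obtain ⟨J, hJ, hmin⟩ : ∃ J, ¬ Q J ∧ ∀ j < J, Q j :=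
    ⟨Nat.find hex, Nat.find_spec hex, fun j hj => not_not.1 (Nat.find_min hex hj)⟩
  have hyJ : y = appendSeq (List.replicate J (pairWord a i i)).flatten
      (shift ((L + L) * J) y) := by
    have := eq_replicate_append (w := pairWord a i i) (y := y) (J := J) fun j hj => by
      have := getD_pairWord_iff.2 ⟨hstart j fun k hk => hmin k (by omega), (hmin j hj).1⟩
      rw [hlen] at this ⊢
      exact this
    rwa [hlen] at this
  set z := shift ((L + L) * J) y with hz
  have hzT : TailsBetween c z := hy.shift _
  have hz0 : AgreeOn L z c := hstart J hmin
  have hdouble : ∀ l, a.length * 2 ^ (l + 1) = 2 * (a.length * 2 ^ l) := fun l => by ring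
  have hzc : SeqLT z c := by simpa using (hzT 0).2
  rcases (T.doubles i).next_block hLpos hz0 hzc (hzT L).1 with h1 | h1
  · have h2 : ¬ AgreeOn L (shift ((L + L) * (J + 1)) y) c := fun h => hJ ⟨h1, h⟩
    have h2' : ¬ AgreeOn L (shift L (shift L z)) c := by
      rwa [shift_shift, hz, shift_shift, show (L + L) * J + (L + L) = (L + L) * (J + 1) by ring]
    have hw := hzT.shift L
    have h3 := ((T.doubles i).next_block_reflect hLpos h1 (by simpa using (hw 0).1)
      (hw L).2).resolve_left h2'
    -- The block `c̄_i` is not followed by `c_i`, so it grows to some maximal `c̄_t` with `t > i`.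
    -- The growth stops because no tail equals `c̄`; then `c_t` follows, which gives the factor `c_i
    -- c̄_t`.
    have hne : reflectSeq (shift L z) ≠ c := fun h => by
      have := (hw 0).1
      rw [← h, reflectSeq_reflectSeq, shift_zero] at this
      exact SeqLT.irrefl _ this
    obtain ⟨t, hit, ht1, ht2⟩ := T.exists_max (k := i + 1) (y := reflectSeq (shift L z))
      (by rw [hdouble]; simpa [reflectSeq_reflectSeq] using h3.reflect) hne
    have ht1' : AgreeOn (a.length * 2 ^ t) (shift L z) (reflectSeq c) := by
      simpa [reflectSeq_reflectSeq] using ht1.reflect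
    have h4 := ((T.doubles t).next_block_reflect (T.len_pos t) ht1' (by simpa using (hw 0).1)
      (hw _).2).resolve_right fun h => ht2 (by simpa [reflectSeq_reflectSeq] using h.reflect)
    refine ⟨J, 1, t, shift (a.length * 2 ^ t) (shift L z), le_rfl, by omega, ?_,
      hw.shift _, h4⟩
    have h5 := eq_appendSeq (getD_pairWord_iff.2 ⟨hz0, ht1'⟩)
    rw [length_pairWord, ← shift_shift] at h5
    rw [List.replicate_one, List.flatten_singleton]
    conv_lhs => rw [hyJ, h5]
  -- The block `c_i` is itself the first half of `c_{i+1}`, so no linking factor occurs.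
  · refine ⟨J, 0, i + 1, z, by omega, by omega, by simpa using hyJ, hzT, ?_⟩
    rwa [hdouble]

/-- Decomposition of the sequences all whose tails lie between the reflection of `c` and `c`. -/
theorem exists_isInfProd {y : ℕ → Fin (m + 1)} (hy : TailsBetween (limitSeq a) y)
    (h0 : AgreeOn a.length y (limitSeq a)) :
    ∃ i js l, StrictMono i ∧ (∀ r, l r ≤ 1) ∧ IsInfProd (factors a 0 i js l) y := by
  classical
  set c := limitSeq a with hc
  let St : (ℕ → Fin (m + 1)) × ℕ → Prop := fun S =>
    TailsBetween c S.1 ∧ AgreeOn (a.length * 2 ^ S.2) S.1 c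
  -- A state consists of the remaining sequence and the index of its initial block. Invalid states
  -- get an arbitrary step, so that the index increases in all cases.
  have hstep : ∀ S : (ℕ → Fin (m + 1)) × ℕ, ∃ (J : ℕ∞) (l : ℕ) (S' : (ℕ → Fin (m + 1)) × ℕ),
      l ≤ 1 ∧ S.2 < S'.2 ∧ (St S →
        (J = ⊤ ∧ S.1 = periodicSeq (pairWord a S.2 S.2)) ∨
        (J ≠ ⊤ ∧ S.1 = appendSeq (List.replicate J.toNat (pairWord a S.2 S.2)).flatten
          (appendSeq (List.replicate l (pairWord a S.2 S'.2)).flatten S'.1) ∧ St S')) := by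
    intro S
    by_cases hS : St S
    · rcases exists_split T hS.1 hS.2 with h | ⟨J, l, i', y', h1, h2, h3, h4, h5⟩
      · exact ⟨⊤, 0, (S.1, S.2 + 1), by omega, by simp, fun _ => Or.inl ⟨rfl, h⟩⟩
      · exact ⟨J, l, (y', i'), h1, h2, fun _ => Or.inr ⟨by simp, by simpa using h3, h4, h5⟩⟩
    · exact ⟨0, 0, (S.1, S.2 + 1), by omega, by simp, fun h => absurd h hS⟩
  choose J l nx hl hlt hSt using hstep
  let S : ℕ → (ℕ → Fin (m + 1)) × ℕ := fun r => nx^[r] (y, 0)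
  have hS : ∀ r, S (r + 1) = nx (S r) := fun r => Function.iterate_succ_apply' nx r _
  let i : ℕ → ℕ := fun r => (S r).2
  let js : ℕ → ℕ∞ := fun r => J (S r)
  have hi : StrictMono i := strictMono_nat_of_lt_succ fun r => by
    simp only [i, hS]; exact hlt _
  have hvalid : ∀ r, (∀ s < r, js s ≠ ⊤) → St (S r) := by
    intro r
    induction r with
    | zero => exact fun _ => ⟨hy, by simpa [S] using h0⟩
    | succ r ih =>
      intro h
      have hr := ih fun s hs => h s (by omega)
      rcases hSt _ hr with h1 | h1
      · exact absurd h1.1 (h r (by omega))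
      · rw [hS]; exact h1.2.2
  set F := factors a 0 i js (fun r => l (S r)) with hF
  have hF1 : ∀ r, F (2 * r + 1) = (pairWord a (i r) (i r), js r) := fun r => by
    simp [hF, factors, pairWord]
  have hF2 : ∀ r, F (2 * r + 2) = (pairWord a (i r) (i (r + 1)), (l (S r) : ℕ∞)) := fun r => by
    have h1 : (2 * r + 1) % 2 = 1 := by omega
    have h2 : (2 * r + 1) / 2 = r := by omega
    simp [hF, factors, pairWord, h1, h2]
  have hFtop : ∀ t, (F t).2 = ⊤ → ∃ r, t = 2 * r + 1 ∧ js r = ⊤ := by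
    intro t ht
    rcases Nat.even_or_odd' t with ⟨r, rfl | rfl⟩
    · cases r with
      | zero => simp [hF, factors] at ht
      | succ r =>
        rw [show 2 * (r + 1) = 2 * r + 2 by ring, hF2] at ht
        simp at ht
    · exact ⟨r, rfl, by rw [hF1] at ht; exact ht⟩
  have hprod : ∀ r, (∀ s < r, js s ≠ ⊤) → y = appendSeq (finProd F (2 * r + 1)) (S r).1 := by
    intro r
    induction r with
    | zero =>
      intro _
      have : finProd F (2 * 0 + 1) = [] := by simp [finProd, hF, factors]
      rw [this, appendSeq_nil]
      rfl
    | succ r ih =>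
      intro h
      have hr : ∀ s < r, js s ≠ ⊤ := fun s hs => h s (by omega)
      rcases hSt _ (hvalid r hr) with h1 | ⟨-, h2, -⟩
      · exact absurd h1.1 (h r (by omega))
      · rw [show 2 * (r + 1) + 1 = 2 * r + 2 + 1 by ring, finProd_succ, finProd_succ, hF1, hF2,
          appendSeq_append, appendSeq_append, ENat.toNat_natCast, hS]
        have hi1 : i (r + 1) = (nx (S r)).2 := by simp only [i, hS]
        rw [hi1]
        conv_lhs => rw [ih hr, h2]
  refine ⟨i, js, fun r => l (S r), hi, fun r => hl _, ?_⟩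
  rw [← hF]
  by_cases htop : ∃ r, js r = ⊤
  · obtain ⟨r, hr, hmin⟩ : ∃ r, js r = ⊤ ∧ ∀ s < r, js s ≠ ⊤ :=
      ⟨Nat.find htop, Nat.find_spec htop, fun s hs => Nat.find_min htop hs⟩
    left
    refine ⟨2 * r + 1, fun t ht htt => ?_, by rw [hF1]; exact hr, ?_⟩
    · obtain ⟨s, rfl, hs⟩ := hFtop t htt
      exact hmin s (by omega) hs
    · rcases hSt _ (hvalid r hmin) with h1 | h1
      · rw [hF1]
        change y = appendSeq _ (periodicSeq (pairWord a (S r).2 (S r).2))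
        rw [← h1.2]
        exact hprod r hmin
      · exact absurd hr h1.1
  · push Not at htop
    right
    have hprod' := fun r => hprod r fun s _ => htop s
    refine ⟨fun t ht => ?_, fun N => ?_, ?_⟩
    · obtain ⟨r, -, hr⟩ := hFtop t ht
      exact htop r hr
    · obtain ⟨v, hv⟩ := finProd_prefix F (show N ≤ 2 * N + 1 by omega)
      have := hprod' N
      rw [hv, appendSeq_append] at this
      exact ⟨_, this⟩
    · by_contra! hcon
      obtain ⟨K, hK⟩ := hcon
      -- the lengths of the partial products are eventually constant
      let g : ℕ → ℕ := fun r => (finProd F (2 * r + 1)).length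
      obtain ⟨R, hR⟩ : ∃ R, ∀ r, g r ≤ g R := by
        have hb : BddAbove (Set.range g) := ⟨K, by rintro _ ⟨r, rfl⟩; exact (hK _).le⟩
        obtain ⟨R, hR⟩ := Nat.sSup_mem (Set.range_nonempty g) hb
        exact ⟨R, fun r => hR ▸ le_csSup hb ⟨r, rfl⟩⟩
      have hconst : ∀ r, R ≤ r → (S r).1 = (S R).1 := by
        intro r hr
        obtain ⟨v, hv⟩ := finProd_prefix F (show 2 * R + 1 ≤ 2 * r + 1 by omega)
        have hlen : g r = g R := by
          refine le_antisymm (hR r) ?_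
          simp only [g]
          rw [hv, List.length_append]; omega
        rw [← shift_length_appendSeq (finProd F (2 * r + 1)) (S r).1, ← hprod' r,
          ← shift_length_appendSeq (finProd F (2 * R + 1)) (S R).1, ← hprod' R]
        exact congrArg (fun k => shift k y) hlen
      have hStR := hvalid R fun s _ => htop s
      -- The constant remainder would start with `c_i` for arbitrarily large `i`, hence be `c`
      -- itself, which is not strictly below `c`.
      have hc' : (S R).1 = c := T.eq_of_agree fun N => by
        refine ⟨i (R + N), (Nat.le_add_left N R).trans (hi.id_le _), ?_⟩
        rw [← hconst (R + N) (by omega)]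
        exact (hvalid (R + N) fun s _ => htop s).2
      have := (hStR.1 0).2
      rw [shift_zero, hc'] at this
      exact SeqLT.irrefl _ this

end

/-! ### Words matched to `a` -/

/-- The first `N` digits of `x` form a word smaller than the first `N` digits of `y`. -/
def PrefixLT (N : ℕ) (x y : ℕ → Fin (m + 1)) : Prop :=
  ∃ k < N, (∀ j < k, x j = y j) ∧ x k < y k

theorem PrefixLT.seqLT {N : ℕ} {x y : ℕ → Fin (m + 1)} (h : PrefixLT N x y) : SeqLT x y := by
  obtain ⟨k, -, h⟩ := h
  exact ⟨k, h⟩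

theorem PrefixLT.congr {N : ℕ} {x y x' y' : ℕ → Fin (m + 1)} (h : PrefixLT N x y)
    (hx : AgreeOn N x x') (hy : AgreeOn N y y') : PrefixLT N x' y' := by
  obtain ⟨k, hk, h1, h2⟩ := h
  exact ⟨k, hk, fun j hj => by rw [← hx j (by omega), ← hy j (by omega), h1 j hj],
    by rwa [← hx k hk, ← hy k hk]⟩

theorem PrefixLT.reflect {N : ℕ} {x y : ℕ → Fin (m + 1)} (h : PrefixLT N x y) :
    PrefixLT N (reflectSeq y) (reflectSeq x) := by
  obtain ⟨k, hk, h1, h2⟩ := h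
  exact ⟨k, hk, fun j hj => by simp [h1 j hj], by simpa using h2⟩

theorem list_lt_iff_prefixLT {A B : List (Fin (m + 1))} {N : ℕ} {f g : ℕ → Fin (m + 1)}
    (hA : A.length = N) (hB : B.length = N) (hf : ∀ j < N, A.getD j 0 = f j)
    (hg : ∀ j < N, B.getD j 0 = g j) : A < B ↔ PrefixLT N f g := by
  rw [List.lt_iff_exists]
  have hA' : ∀ (j : ℕ) (h : j < A.length), A[j] = f j := fun j h => by
    rw [← hf j (by omega), List.getD_eq_getElem _ _ h]
  have hB' : ∀ (j : ℕ) (h : j < B.length), B[j] = g j := fun j h => by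
    rw [← hg j (by omega), List.getD_eq_getElem _ _ h]
  constructor
  · rintro (⟨-, h⟩ | ⟨k, h1, h2, h3, h4⟩)
    · omega
    · rw [hA', hB'] at h4
      exact ⟨k, by omega, fun j hj => by
        rw [← hA' j (by omega), ← hB' j (by omega), h3 j hj], h4⟩
  · rintro ⟨k, hk, h1, h2⟩
    refine Or.inr ⟨k, by omega, by omega, fun j hj => ?_, ?_⟩
    · rw [hA', hB', h1 j hj]
    · rwa [hA', hB']

theorem take_eq_replicate_iff {u : List (Fin (m + 1))} {z : ℕ → Fin (m + 1)} {l : ℕ}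
    (hl : l ≤ u.length) (hz : ∀ j < u.length, u.getD j 0 = z j) (d : Fin (m + 1)) :
    u.take l = List.replicate l d ↔ ∀ j < l, z j = d := by
  rw [List.eq_replicate_iff]
  simp only [List.length_take, Nat.min_eq_left hl, true_and]
  constructor
  · intro h j hj
    rw [← hz j (by omega), List.getD_eq_getElem _ _ (by omega)]
    exact h _ (List.mem_take_iff_getElem.2 ⟨j, by omega, rfl⟩)
  · intro h e he
    obtain ⟨j, hj, rfl⟩ := List.mem_take_iff_getElem.1 he
    rw [← h j (by omega), ← hz j (by omega), List.getD_eq_getElem _ _ (by omega)]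

/-- The windows of length `n` in `u a` coincide with those in `u a^∞`, so the conditions on words
become conditions on prefixes of tails of one sequence. -/
theorem matched_iff {a u : List (Fin (m + 1))} (hu : u ≠ []) :
    Matched a u ↔ appendSeq u (periodicSeq a) (u.length - 1) < Fin.last m ∧
      ∀ l, 1 ≤ l → l ≤ u.length →
        ((∃ j < l, appendSeq u (periodicSeq a) j < Fin.last m) →
          ¬ PrefixLT a.length (periodicSeq a) (shift l (appendSeq u (periodicSeq a)))) ∧
        ((∃ j < l, 0 < appendSeq u (periodicSeq a) j) →
          ¬ PrefixLT a.length (shift l (appendSeq u (periodicSeq a)))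
            (reflectSeq (periodicSeq a))) := by
  have hpos := List.length_pos_iff.2 hu
  have hz : ∀ j < u.length, u.getD j 0 = appendSeq u (periodicSeq a) j := fun j hj =>
    (appendSeq_of_lt _ _ hj).symm
  have hlast : u.getLast hu = appendSeq u (periodicSeq a) (u.length - 1) := by
    rw [← hz _ (by omega), List.getD_eq_getElem _ _ (by omega), List.getLast_eq_getElem]
  have hblock : ∀ l ≤ u.length, (((u ++ a).drop l).take a.length).length = a.length ∧
      ∀ j < a.length, (((u ++ a).drop l).take a.length).getD j 0 =
        shift l (appendSeq u (periodicSeq a)) j := by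
    intro l hl
    have hlen : (((u ++ a).drop l).take a.length).length = a.length := by
      simp only [List.length_take, List.length_drop, List.length_append]; omega
    refine ⟨hlen, fun j hj => ?_⟩
    rw [List.getD_eq_getElem _ _ (by omega), List.getElem_take, List.getElem_drop,
      ← List.getD_eq_getElem _ 0, shift_apply]
    by_cases hju : l + j < u.length
    · rw [List.getD_append _ _ _ _ hju, hz _ hju]
    · rw [List.getD_append_right _ _ _ _ (by omega), ← periodicSeq_of_lt a (by omega)]
      simp [appendSeq, hju]
  have hper : ∀ j < a.length, a.getD j 0 = periodicSeq a j := fun j hj =>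
    (periodicSeq_of_lt a hj).symm
  have hrefl : ∀ j < a.length, (reflect a).getD j 0 = reflectSeq (periodicSeq a) j :=
    fun j hj => by rw [getD_reflect _ hj, hper j hj, reflectSeq_apply]
  have hne : ∀ l ≤ u.length, ∀ d, u.take l ≠ List.replicate l d ↔
      ∃ j < l, appendSeq u (periodicSeq a) j ≠ d := fun l hl d => by
    rw [Ne, take_eq_replicate_iff hl hz]; push Not; rfl
  unfold Matched
  refine and_congr ⟨fun ⟨_, h⟩ => hlast ▸ h, fun h => ⟨hu, hlast ▸ h⟩⟩ ?_
  refine forall_congr' fun l => forall_congr' fun _ => forall_congr' fun hl => ?_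
  obtain ⟨h1, h2⟩ := hblock l hl
  rw [hne l hl, hne l hl, ← not_lt, ← not_lt, list_lt_iff_prefixLT rfl h1 hper h2,
    list_lt_iff_prefixLT h1 (length_reflect a) h2 hrefl]
  simp only [Fin.lt_last_iff_ne_last, Fin.pos_iff_ne_zero]

/-- The first digits of a sequence, as a word. -/
def initWord (N : ℕ) (z : ℕ → Fin (m + 1)) : List (Fin (m + 1)) := (List.range N).map z

@[simp] theorem length_initWord (N : ℕ) (z : ℕ → Fin (m + 1)) : (initWord N z).length = N := by
  simp [initWord]

theorem eq_appendSeq_initWord (N : ℕ) (z : ℕ → Fin (m + 1)) :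
    z = appendSeq (initWord N z) (shift N z) := by
  have := eq_appendSeq (w := initWord N z) (y := z) fun j hj => by
    rw [length_initWord] at hj
    simp [initWord, List.getD_eq_getElem?_getD, hj]
  rwa [length_initWord] at this

theorem AgreeOn.initWord_eq {N : ℕ} {x y : ℕ → Fin (m + 1)} (h : AgreeOn N x y) :
    initWord N x = initWord N y :=
  List.map_congr_left fun j hj => h j (List.mem_range.1 hj)

/-- As `c` starts with `a⁺`, a comparison of the first `n` digits with `a` is enough. -/
theorem Tower.lt_of_not_prefixLT {n : ℕ} {x c w : ℕ → Fin (m + 1)} (T : Tower n x c)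
    (h : ¬ PrefixLT n x w) : SeqLT w c := by
  have hn := T.adm.pos
  have hincr : x (n - 1) < c (n - 1) := by rw [Fin.lt_def]; have := T.incr; omega
  rcases seqLT_trichotomy w x with ⟨k, h1, h2⟩ | rfl | ⟨k, h1, h2⟩
  · exact SeqLT.trans ⟨k, h1, h2⟩ T.periodic_lt
  · exact T.periodic_lt
  · have hk : n ≤ k := by
      by_contra hk
      exact h ⟨k, by omega, h1, h2⟩
    exact ⟨n - 1, fun j hj => by rw [← h1 j (by omega), T.agree j hj],
      by rw [← h1 _ (by omega)]; exact hincr⟩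

theorem Tower.tailsBetween_periodic {n : ℕ} {x c : ℕ → Fin (m + 1)} (T : Tower n x c)
    (hu : ∀ k, ¬ SeqLT x (shift k x)) (hl : ∀ k, SeqLT (reflectSeq x) (shift k x)) :
    TailsBetween c x := by
  refine fun k => ⟨T.periodic_lt.reflect.trans (hl k), ?_⟩
  rcases seqLT_trichotomy (shift k x) x with h | h | h
  · exact h.trans T.periodic_lt
  · rw [h]; exact T.periodic_lt
  · exact absurd h (hu k)

/-! ### The stated form and the lexicographic conditions -/

section

variable {a : List (Fin (m + 1))} (T : Tower a.length (periodicSeq a) (limitSeq a))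
  (hu : ∀ k, ¬ SeqLT (periodicSeq a) (shift k (periodicSeq a)))
  (hl : ∀ k, SeqLT (reflectSeq (periodicSeq a)) (shift k (periodicSeq a)))
include T hu hl

/-- The sequences of the given form satisfy the lexicographic conditions for the right endpoint
and violate those for the left endpoint. -/
theorem conditions_of_hasForm {b : ℕ → Fin (m + 1)} (h : HasForm a b) :
    UpperCond (limitSeq a) b ∧ UpperCond (limitSeq a) (reflectSeq b) ∧
      ¬ UpperCond (periodicSeq a) b := by
  obtain ⟨w, j, i, js, l, s, hw, hj, hi, hl1, hs, rfl⟩ := h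
  set x := periodicSeq a with hx
  set c := limitSeq a with hc
  have hn := T.adm.pos
  obtain ⟨hsT, hsag, hsx⟩ : TailsBetween c s ∧ AgreeOn (a.length - 1) s x ∧ ¬ SeqLT s x := by
    rcases hj with rfl | rfl
    · have hF : IsPairProduct a (fun t => factors a 0 i js l (t + 1))
          (fun t => i (t / 2)) (fun t => i ((t + 1) / 2)) := by
        intro t
        refine ⟨?_, hi.monotone (by omega), le_rfl, ?_⟩
        · by_cases ht : t % 2 = 0
          · have : (t + 1) / 2 = t / 2 := by omega
            simp [factors, ht, this, pairWord]
          · have : (t + 1) / 2 = t / 2 + 1 := by omega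
            simp [factors, ht, this, pairWord]
        · by_cases ht : t % 2 = 0
          · left
            beta_reduce
            rw [show (t + 1) / 2 = t / 2 by omega]
          · right
            simp only [factors, ht, if_false]
            exact_mod_cast hl1 _
      obtain ⟨h1, h2⟩ := tailsBetween_of_isInfProd T hF (hs.tail rfl)
      refine ⟨h1, fun k hk => by rw [h2 k (by omega), T.agree k hk], SeqLT.asymm ?_⟩
      refine ⟨a.length - 1, fun k hk => by rw [h2 k (by omega), T.agree k hk], ?_⟩
      rw [h2 _ (by omega), Fin.lt_def, T.incr]
      omega
    · have hsx : s = x := by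
        rcases hs with ⟨r, h1, -, h3⟩ | ⟨h1, -⟩
        · cases r with
          | zero => rw [h3]; simp [finProd, factors, hx]
          | succ r => exact absurd rfl (h1 0 (by omega))
        · exact absurd rfl (h1 0)
      rw [hsx]
      exact ⟨T.tailsBetween_periodic hu hl, fun _ _ => rfl, SeqLT.irrefl x⟩
  have hwne : w ≠ [] := hw.1.1
  have hwpos := List.length_pos_iff.2 hwne
  obtain ⟨hlast, hm⟩ := (matched_iff hwne).1 hw
  set z := appendSeq w x with hz
  -- A window that starts inside `w` reaches at most `n - 1` digits into `s`, and there `c_0` and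
  -- `a` agree.
  have hag : AgreeOn (w.length + (a.length - 1)) (appendSeq w s) z := by
    intro k hk
    simp only [hz, appendSeq]
    split_ifs with h
    · rfl
    · exact hsag _ (by omega)
  have hshift : ∀ k, w.length ≤ k → shift k (appendSeq w s) = shift (k - w.length) s :=
    fun k hk => by
      rw [← shift_appendSeq w s, show w.length + (k - w.length) = k by omega]
  have hshag : ∀ k, k < w.length →
      AgreeOn a.length (shift k z) (shift k (appendSeq w s)) := fun k hk i hi => by
    rw [shift_apply, shift_apply, hag _ (by omega)]
  refine ⟨fun k hk => ?_, fun k hk => ?_, fun h => ?_⟩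
  · by_cases hkw : k + 1 < w.length
    · refine T.lt_of_not_prefixLT fun h => ?_
      refine (hm (k + 1) (by omega) hkw.le).1 ⟨k, by omega, ?_⟩
        (h.congr (fun _ _ => rfl) (hshag _ hkw).symm)
      rwa [← hag k (by omega)]
    · rw [hshift _ (by omega)]
      exact (hsT _).2
  · by_cases hkw : k + 1 < w.length
    · refine T.lt_of_not_prefixLT fun h => ?_
      have h' := h.reflect
      rw [shift_reflectSeq, reflectSeq_reflectSeq] at h'
      refine (hm (k + 1) (by omega) hkw.le).2 ⟨k, by omega, ?_⟩
        (h'.congr (hshag _ hkw).symm (fun _ _ => rfl))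
      rw [← hag k (by omega), Fin.pos_iff_ne_zero]
      rintro h0
      rw [reflectSeq_apply, h0, Fin.rev_zero] at hk
      exact lt_irrefl _ hk
    · rw [shift_reflectSeq, hshift _ (by omega)]
      have := (hsT (k + 1 - w.length)).1.reflect
      rwa [reflectSeq_reflectSeq] at this
  · have h1 := h (w.length - 1) (by rwa [hag _ (by omega)])
    rw [Nat.sub_add_cancel hwpos, shift_length_appendSeq] at h1
    exact hsx h1

/-- The word ends `J` copies of `a` after the position `N` of the first violation. Windows that
start up to `N` obey the bounds because no violation occurs earlier; later windows belong to tails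
of `a^∞`. The last digit is `b N` or the last digit of `a`, both below `m`. -/
theorem matched_initWord {b : ℕ → Fin (m + 1)} {N : ℕ} (hN : b N < Fin.last m)
    (hmin1 : ∀ k < N, b k < Fin.last m → SeqLT (shift (k + 1) b) (periodicSeq a))
    (hmin2 : ∀ k < N, reflectSeq b k < Fin.last m →
      SeqLT (shift (k + 1) (reflectSeq b)) (periodicSeq a))
    (hag : AgreeOn (a.length - 1) (shift (N + 1) b) (periodicSeq a)) (J : ℕ) :
    Matched a (initWord (N + 1 + a.length * J) (splice (N + 1) b (periodicSeq a))) := by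
  set x := periodicSeq a with hx
  set z := splice (N + 1) b x with hz
  set u := initWord (N + 1 + a.length * J) z with hu'
  have hn := T.adm.pos
  have hper : ∀ J i, x (a.length * J + i) = x i := fun J i => by
    simp [hx, periodicSeq]
  have hzs : shift (N + 1) z = x := shift_splice _ _ _
  have hz1 : ∀ k, z (N + 1 + k) = x k := fun k => by rw [← hzs, shift_apply]
  have hlen : u.length = N + 1 + a.length * J := length_initWord _ _
  have hzu : appendSeq u x = z := by
    have h1 := eq_appendSeq_initWord (N + 1 + a.length * J) z
    have h2 : shift (N + 1 + a.length * J) z = x := by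
      funext k
      rw [shift_apply, Nat.add_assoc, hz1, hper]
    rw [h2] at h1
    exact h1.symm
  have hbz : AgreeOn (N + 1 + (a.length - 1)) z b := by
    intro k hk
    by_cases hkN : k < N + 1
    · exact splice_agree _ _ _ k hkN
    · have := hag (k - (N + 1)) (by omega)
      rw [shift_apply, ← hz1, show N + 1 + (k - (N + 1)) = k by omega] at this
      exact this.symm
  have hshift : ∀ l, l ≤ N → AgreeOn a.length (shift l z) (shift l b) := fun l hlN k hk => by
    rw [shift_apply, shift_apply, hbz _ (by omega)]
  have hune : u ≠ [] := by rw [← List.length_pos_iff, hlen]; omega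
  rw [matched_iff hune, ← hx, hzu, hlen]
  refine ⟨?_, fun l hl1 hl2 => ⟨?_, ?_⟩⟩
  · cases J with
    | zero =>
      rw [show N + 1 + a.length * 0 - 1 = N by omega, hbz N (by omega)]
      exact hN
    | succ J =>
      rw [show N + 1 + a.length * (J + 1) - 1 = N + 1 + (a.length * J + (a.length - 1)) by
        rw [Nat.mul_add, Nat.mul_one]; omega, hz1, hper, Fin.lt_def, Fin.val_last]
      have := T.incr
      have := Fin.is_le (limitSeq a (a.length - 1))
      omega
  · rintro ⟨j, hj, hzj⟩ hlt
    by_cases hlN : l ≤ N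
    · rw [hbz j (by omega)] at hzj
      exact (shift_lt_of_forall_lt (hu 1) (fun k hk => hmin1 k (by omega)) hj hzj).asymm
        (hlt.congr (fun _ _ => rfl) (hshift l hlN)).seqLT
    · refine hu (l - (N + 1)) ?_
      rw [← hzs, shift_shift, show N + 1 + (l - (N + 1)) = l by omega, hzs]
      exact hlt.seqLT
  · rintro ⟨j, hj, hzj⟩ hlt
    by_cases hlN : l ≤ N
    · rw [hbz j (by omega)] at hzj
      have h1 := shift_lt_of_forall_lt (b := reflectSeq b) (hu 1)
        (fun k hk => hmin2 k (by omega)) hj (rev_lt_last hzj)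
      have h2 := (hlt.congr (hshift l hlN) (fun _ _ => rfl)).seqLT.reflect
      rw [reflectSeq_reflectSeq] at h2
      exact h1.asymm h2
    · refine (hl (l - (N + 1))).asymm ?_
      rw [← hzs, shift_shift, show N + 1 + (l - (N + 1)) = l by omega, hzs]
      exact hlt.seqLT

/-- A first violation of the conditions for the left endpoint yields the form. -/
theorem hasForm_of_first_violation {b : ℕ → Fin (m + 1)} (h1 : UpperCond (limitSeq a) b)
    (h2 : UpperCond (limitSeq a) (reflectSeq b)) {N : ℕ} (hN : b N < Fin.last m)
    (hbad : ¬ SeqLT (shift (N + 1) b) (periodicSeq a))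
    (hmin1 : ∀ k < N, b k < Fin.last m → SeqLT (shift (k + 1) b) (periodicSeq a))
    (hmin2 : ∀ k < N, reflectSeq b k < Fin.last m →
      SeqLT (shift (k + 1) (reflectSeq b)) (periodicSeq a)) : HasForm a b := by
  classical
  have hmatch := matched_initWord T hu hl hN hmin1 hmin2
  set x := periodicSeq a with hx
  set c := limitSeq a with hc
  set y := shift (N + 1) b with hy
  have hn := T.adm.pos
  have hane : a ≠ [] := List.length_pos_iff.1 hn
  have hx0 : 0 < x 0 := by
    obtain ⟨j, -, hj⟩ := hl 0
    have hxj : 0 < x j := by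
      simp only [reflectSeq_apply, shift_apply, Nat.zero_add] at hj
      rw [Fin.pos_iff_ne_zero]
      intro h
      rw [h] at hj
      exact absurd (Fin.zero_le _) (not_le.2 hj)
    have : AgreeOn 0 (shift j x) x := fun k hk => absurd hk (Nat.not_lt_zero k)
    exact hxj.trans_le (this.le_of_lt (hu j))
  -- A positive digit activates the reflected condition for all later tails. The lower bound for `y`
  -- itself comes from `c̄ < x̄ < x ≤ y`.
  have hy0 : 0 < b (N + 1) := by
    have : AgreeOn 0 x y := fun k hk => absurd hk (Nat.not_lt_zero k)
    exact hx0.trans_le (this.le_of_lt hbad)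
  have hc1 : ¬ SeqLT c (shift 1 c) := (T.shift_lt one_pos).asymm
  have hyT : TailsBetween c y := by
    intro k
    rw [hy, shift_shift]
    refine ⟨?_, h1.shift_lt hc1 (show N < N + 1 + k by omega) hN⟩
    rcases Nat.eq_zero_or_pos k with rfl | hk
    · exact (T.periodic_lt.reflect.trans (by simpa using hl 0)).trans_not hbad
    · have := (h2.shift_lt hc1 (show N + 1 < N + 1 + k by omega) (rev_lt_last hy0)).reflect
      rwa [shift_reflectSeq, reflectSeq_reflectSeq] at this
  by_cases hall : ∀ j, AgreeOn a.length (shift (a.length * j) y) x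
  · have hyx : y = x := eq_periodicSeq hane fun j i hi => by
      rw [← periodicSeq_of_lt a hi]; exact hall j i hi
    refine ⟨_, ⊤, id, fun _ => 0, fun _ => 0, x, hmatch (fun _ _ => congrFun hyx _) 0,
      Or.inr rfl, strictMono_id, fun _ => Nat.zero_le _,
      Or.inl ⟨0, by simp, rfl, by simp [finProd, factors, hx]⟩, ?_⟩
    have h3 := eq_appendSeq_initWord (N + 1) b
    rw [← hy, hyx] at h3
    rw [Nat.mul_zero, Nat.add_zero (N + 1), (splice_agree (N + 1) b x).initWord_eq]
    exact h3
  · push Not at hall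
    obtain ⟨J, hJ, hmin⟩ : ∃ J, ¬ AgreeOn a.length (shift (a.length * J) y) x ∧
        ∀ j < J, AgreeOn a.length (shift (a.length * j) y) x :=
      ⟨Nat.find hall, Nat.find_spec hall, fun j hj => not_not.1 (Nat.find_min hall hj)⟩
    -- Removing common copies of `a` preserves `y ≥ x`; so the first block that differs from `a`
    -- must be `c_0`.
    have hge : ∀ j ≤ J, ¬ SeqLT (shift (a.length * j) y) x := by
      intro j
      induction j with
      | zero => simpa using hbad
      | succ j ih =>
        rintro hj ⟨k, hk1, hk2⟩
        refine ih (by omega) ⟨a.length + k, fun i hi => ?_, ?_⟩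
        · by_cases hia : i < a.length
          · exact hmin j (by omega) i hia
          · have := hk1 (i - a.length) (by omega)
            rw [shift_apply, Nat.mul_succ, ← T.periodic,
              show a.length + (i - a.length) = i by omega,
              show a.length * j + a.length + (i - a.length) = a.length * j + i by omega] at this
            exact this
        · rw [shift_apply, ← Nat.add_assoc, T.periodic, ← Nat.mul_succ]
          exact hk2
    have hJc : AgreeOn a.length (shift (a.length * J) y) c :=
      (T.first_block (hge J le_rfl) (hyT _).2).resolve_left hJ
    have hag : AgreeOn (a.length * J) y x := fun k hk => by
      have := hmin (k / a.length) (Nat.div_lt_of_lt_mul hk) (k % a.length) (Nat.mod_lt _ hn)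
      rw [shift_apply, Nat.div_add_mod] at this
      rw [this, hx, periodicSeq, periodicSeq, Nat.mod_mod]
    have hag' : AgreeOn (a.length - 1) y x := by
      cases J with
      | zero =>
        intro k hk
        have := hJc k (by omega)
        rw [Nat.mul_zero, shift_zero] at this
        rw [this, T.agree k hk]
      | succ J => exact hag.mono (by rw [Nat.mul_succ]; omega)
    obtain ⟨i, js, l, hi, hl1, hprod⟩ := exists_isInfProd T (hyT.shift (a.length * J)) hJc
    refine ⟨_, 0, i, js, l, _, hmatch hag' J, Or.inl rfl, hi, hl1, hprod, ?_⟩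
    have h3 := eq_appendSeq_initWord (N + 1 + a.length * J) b
    have h4 : AgreeOn (N + 1 + a.length * J) b (splice (N + 1) b x) := by
      intro k hk
      by_cases hkN : k < N + 1
      · exact (splice_agree (N + 1) b x k hkN).symm
      · have := hag (k - (N + 1)) (by omega)
        rw [hy, shift_apply, show N + 1 + (k - (N + 1)) = k by omega] at this
        rw [this, splice, if_neg hkN]
    rw [← h4.initWord_eq, hy, shift_shift]
    exact h3

/-- The earliest violation is taken among those of `b` and of its reflection together, so that
neither sequence has an earlier one. -/
theorem hasForm_of_conditions {b : ℕ → Fin (m + 1)} (h1 : UpperCond (limitSeq a) b)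
    (h2 : UpperCond (limitSeq a) (reflectSeq b))
    (h3 : ¬ (UpperCond (periodicSeq a) b ∧ UpperCond (periodicSeq a) (reflectSeq b))) :
    HasForm a b ∨ HasForm a (reflectSeq b) := by
  classical
  let Bad : (ℕ → Fin (m + 1)) → ℕ → Prop := fun b n =>
    b n < Fin.last m ∧ ¬ SeqLT (shift (n + 1) b) (periodicSeq a)
  have hex : ∃ n, Bad b n ∨ Bad (reflectSeq b) n := by
    by_contra! hcon
    refine h3 ⟨fun n hn => ?_, fun n hn => ?_⟩
    · by_contra h; exact (hcon n).1 ⟨hn, h⟩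
    · by_contra h; exact (hcon n).2 ⟨hn, h⟩
  have hmin : ∀ k < Nat.find hex, ∀ d, d = b ∨ d = reflectSeq b → d k < Fin.last m →
      SeqLT (shift (k + 1) d) (periodicSeq a) := by
    intro k hk d hd hdk
    by_contra h
    refine Nat.find_min hex hk ?_
    rcases hd with rfl | rfl
    · exact Or.inl ⟨hdk, h⟩
    · exact Or.inr ⟨hdk, h⟩
  rcases Nat.find_spec hex with h | h
  · exact Or.inl (hasForm_of_first_violation T hu hl h1 h2 h.1 h.2
      (fun k hk => hmin k hk _ (Or.inl rfl)) fun k hk => hmin k hk _ (Or.inr rfl))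
  · exact Or.inr (hasForm_of_first_violation T hu hl h2 (by rwa [reflectSeq_reflectSeq]) h.1 h.2
      (fun k hk => hmin k hk _ (Or.inr rfl))
      fun k hk => hmin k hk _ (Or.inl (reflectSeq_reflectSeq b)))

end

end QExpansion

/-! ### The main theorem -/

theorem theorem5p4 (m : ℕ) (hm : 1 ≤ m) (q₀ q₀' : ℝ)
    (hcomp : QExpansion.IsComponentInterval (QExpansion.complementSet m) q₀ q₀')
    (hM : (((m / 2 + 1 : ℕ)) : ℝ) < q₀)
    (α : ℕ → Fin (m + 1)) (hα : QExpansion.IsQuasiGreedy q₀ 1 α)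
    (a : List (Fin (m + 1))) (ha : QExpansion.IsSmallestBlock a α)
    (b : ℕ → Fin (m + 1)) :
    b ∈ QExpansion.univoqueSeqs m q₀' \ QExpansion.univoqueSeqs m q₀ ↔
      QExpansion.HasForm a b ∨ QExpansion.HasForm a (QExpansion.reflectSeq b) := by
  obtain ⟨hq, hqr, hrm, T, hG, hG', hl⟩ := QExpansion.tower_of_component hm hcomp hM hα ha
  have hu := hG.shift_le hq
  have key : ∀ b, QExpansion.HasForm a b →
      b ∈ QExpansion.univoqueSeqs m q₀' \ QExpansion.univoqueSeqs m q₀ := fun b h => by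
    obtain ⟨h1, h2, h3⟩ := QExpansion.conditions_of_hasForm T hu hl h
    rw [Set.mem_sdiff, QExpansion.mem_univoqueSeqs_iff (hq.trans hqr) hrm hG',
      QExpansion.mem_univoqueSeqs_iff hq (hqr.le.trans hrm) hG]
    exact ⟨⟨h1, h2⟩, fun h => h3 h.1⟩
  constructor
  · intro h
    rw [Set.mem_sdiff, QExpansion.mem_univoqueSeqs_iff (hq.trans hqr) hrm hG',
      QExpansion.mem_univoqueSeqs_iff hq (hqr.le.trans hrm) hG] at h
    exact QExpansion.hasForm_of_conditions T hu hl h.1.1 h.1.2 h.2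
  · rintro (h | h)
    · exact key b h
    · have := key _ h
      rwa [Set.mem_sdiff, QExpansion.reflect_mem_univoqueSeqs (hq.trans hqr),
        QExpansion.reflect_mem_univoqueSeqs hq] at this
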